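/- Base stations (BSs) are located at the points $x_i$ of a homogeneous Poisson point process $\Phi$ in $\mathbb{R}^2$ with density $\lambda>0$; the channel power gains $g_{x_i}$ are i.i.d. exponential with mean $1$ (Rayleigh fading), independent of $\Phi$. All BSs have height $h\ge 0$, there is a single pathloss exponent $\alpha>2$, and $\ell(r,h)=(r^2+h^2)^{-\alpha/2}$. For the typical user at the origin, the signal-to-interference ratio with serving BS $x\in\Phi$ is $$\mathrm{SIR}_x=\frac{g_x\,\ell(\|x\|,h)}{\sum_{y\in\Phi\setminus\{x\}}g_y\,\ell(\|y\|,h)} .$$ For a threshold $\theta>0$ the coverage probability is $\Pr[\mathrm{SIR}_x>\theta]$, where $x$ is the BS closest to the origin (closest association, $P^{(C)}_{\mathrm{cov}}(\theta,\lambda)$) or the BS with the highest SIR (strongest association, $P^{(S)}_{\mathrm{cov}}(\theta,\lambda)$). Let $\eta(s,m,r)={}_2F_1\big(m,-\tfrac{2}{\alpha};1-\tfrac{2}{\alpha};-\tfrac{s}{m r^{\alpha}}\big)$ with the Gauss hypergeometric function ${}_2F_1$ (analytically continued to the negative real axis). Theorem. (a) For every $h\ge 0$ and $\theta>0$, $$P^{(C)}_{\mathrm{cov}}(\theta,\lambda)=\frac{1}{\eta(\theta,1,1)}\exp\!\big(-\pi\lambda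 h^2(\eta(\theta,1,1)-1)\big);$$ in particular the first factor is the coverage probability for $h=0$. (b) For every $h>0$ and $\theta>0$, the integral $$J(\theta,\lambda)=2\pi\lambda\int_h^\infty \exp\!\big(-\pi\lambda h^2(\eta(\theta r^\alpha,1,h)-1)\big)\,r\,dr$$ is finite and equals the expected number of BSs $x\in\Phi$ with $\mathrm{SIR}_x>\theta$. If moreover $\theta\ge 1$, then $P^{(S)}_{\mathrm{cov}}(\theta,\lambda)=J(\theta,\lambda)$. -/

import Mathlib

open MeasureTheory ProbabilityTheory
open scoped ENNReal NNReal

noncomputable section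

/-- The plane `ℝ²` with its Euclidean norm and Lebesgue measure. -/
abbrev Plane : Type := EuclideanSpace ℝ (Fin 2)

/-- The number of points of the configuration `{x i ω : i ∈ ℕ}` (counted with multiplicity)
that fall in `B`. -/
def pointCount {Ω : Type*} (x : ℕ → Ω → Plane) (B : Set Plane) (ω : Ω) : ℕ∞ :=
  Set.encard {i : ℕ | x i ω ∈ B}

/-- The random points `x 0, x 1, …` (in an arbitrary enumeration) form a homogeneous Poisson point
process in the plane with density `lam`: the number of points in every Borel set `B` of finite area
is Poisson distributed with mean `lam * |B|`, and the numbers of points in finitely many pairwise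
disjoint such sets are independent. -/
structure IsHomogeneousPPP {Ω : Type*} [MeasurableSpace Ω] (P : Measure Ω) (lam : ℝ≥0)
    (x : ℕ → Ω → Plane) : Prop where
  measurable_point : ∀ i, Measurable (x i)
  count_law : ∀ B : Set Plane, MeasurableSet B → volume B < ∞ →
    HasLaw (pointCount x B)
      ((poissonMeasure (lam * (volume B).toNNReal)).map (fun n : ℕ => (n : ℕ∞))) P
  count_indep : ∀ (n : ℕ) (B : Fin n → Set Plane), (∀ j, MeasurableSet (B j)) →
    (∀ j, volume (B j) < ∞) → Pairwise (fun j k => Disjoint (B j) (B k)) →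
    iIndepFun (fun j => pointCount x (B j)) P

/-- The marked Poisson point process `{(x i, g i)}` of base stations: the locations form a
homogeneous Poisson point process with density `lam`, and, independently of the locations, the
channel power fading gains are i.i.d. exponential with unit mean (Rayleigh fading). -/
structure IsRayleighMarkedPPP {Ω : Type*} [MeasurableSpace Ω] (P : Measure Ω) (lam : ℝ≥0)
    (x : ℕ → Ω → Plane) (g : ℕ → Ω → ℝ) : Prop where
  ppp : IsHomogeneousPPP P lam x
  measurable_gain : ∀ i, Measurable (g i)
  gain_law : ∀ i, HasLaw (g i) (expMeasure 1) P
  gain_indep : iIndepFun g P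
  indep : IndepFun (fun ω i => x i ω) (fun ω i => g i ω) P

/-- Pathloss at horizontal distance `r` from a base station at height `h`. -/
def pathloss (α h r : ℝ) : ℝ := (r ^ 2 + h ^ 2) ^ (-(α / 2))

/-- Power received at the origin from base station `i`. -/
def receivedPower {Ω : Type*} (α h : ℝ) (x : ℕ → Ω → Plane) (g : ℕ → Ω → ℝ) (i : ℕ) (ω : Ω) :
    ℝ≥0∞ :=
  ENNReal.ofReal (g i ω * pathloss α h ‖x i ω‖)

/-- Aggregate interference power when base station `i` is the serving one. -/
def interference {Ω : Type*} (α h : ℝ) (x : ℕ → Ω → Plane) (g : ℕ → Ω → ℝ) (i : ℕ) (ω : Ω) :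
    ℝ≥0∞ :=
  ∑' j : {j : ℕ // j ≠ i}, receivedPower α h x g j ω

/-- Signal-to-interference ratio at the origin when base station `i` is the serving one. -/
def sir {Ω : Type*} (α h : ℝ) (x : ℕ → Ω → Plane) (g : ℕ → Ω → ℝ) (i : ℕ) (ω : Ω) : ℝ≥0∞ :=
  receivedPower α h x g i ω / interference α h x g i ω

/-- Base station `i` is closest to the origin. -/
def IsClosest {Ω : Type*} (x : ℕ → Ω → Plane) (i : ℕ) (ω : Ω) : Prop :=
  ∀ j, ‖x i ω‖ ≤ ‖x j ω‖

/-- Base station `i` offers the highest signal-to-interference ratio. -/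
def IsStrongest {Ω : Type*} (α h : ℝ) (x : ℕ → Ω → Plane) (g : ℕ → Ω → ℝ) (i : ℕ) (ω : Ω) :
    Prop :=
  ∀ j, sir α h x g j ω ≤ sir α h x g i ω

/-- Coverage probability with closest base station association: the probability that the SIR
offered by the closest base station is larger than the threshold `θ`. -/
def coverageClosest {Ω : Type*} [MeasurableSpace Ω] (P : Measure Ω) (α h : ℝ)
    (x : ℕ → Ω → Plane) (g : ℕ → Ω → ℝ) (θ : ℝ) : ℝ :=
  P.real {ω | ∃ i, IsClosest x i ω ∧ ENNReal.ofReal θ < sir α h x g i ω}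

/-- Coverage probability with strongest base station association: the probability that the SIR
offered by the base station with the highest SIR is larger than the threshold `θ`. -/
def coverageStrongest {Ω : Type*} [MeasurableSpace Ω] (P : Measure Ω) (α h : ℝ)
    (x : ℕ → Ω → Plane) (g : ℕ → Ω → ℝ) (θ : ℝ) : ℝ :=
  P.real {ω | ∃ i, IsStrongest α h x g i ω ∧ ENNReal.ofReal θ < sir α h x g i ω}

/-- Expected number of base stations whose SIR is larger than the threshold `θ`. -/
def meanCoveringStations {Ω : Type*} [MeasurableSpace Ω] (P : Measure Ω) (α h : ℝ)
    (x : ℕ → Ω → Plane) (g : ℕ → Ω → ℝ) (θ : ℝ) : ℝ≥0∞ :=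
  ∫⁻ ω, (({i : ℕ | ENNReal.ofReal θ < sir α h x g i ω}.encard : ℕ∞) : ℝ≥0∞) ∂P

/-- The Gauss hypergeometric function `₂F₁(a, b; c; z)` at real `z < 1`: the hypergeometric series
for `|z| < 1` and its analytic continuation to `z ≤ -1`, written with the Pfaff transformation
`₂F₁(a, b; c; z) = (1 - z)^(-a) ₂F₁(a, c - b; c; z / (z - 1))`, where `0 < z / (z - 1) < 1`. -/
def gaussHypergeometric (a b c z : ℝ) : ℝ :=
  if |z| < 1 then ordinaryHypergeometric a b c z
  else (1 - z) ^ (-a) * ordinaryHypergeometric a (c - b) c (z / (z - 1))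

/-- `η(s, m, r) = ₂F₁(m, -2/α; 1 - 2/α; -s / (m r^α))`. -/
def eta (α s m r : ℝ) : ℝ :=
  gaussHypergeometric m (-(2 / α)) (1 - 2 / α) (-(s / (m * r ^ α)))

end

/-!
Both parts rest on a Mecke-type formula. For a Poisson process `(X i)` with intensity measure `ν`, a
mark `ρ` and a kernel `F` that is monotone and left-continuous in the mark,
`E ∑ i, ∏ j ≠ i, F (ρ (X i)) (X j) = ∫ exp (-∫ (1 - F (ρ p) q) dν(q)) dν(p)`.
For finitely many marks and a kernel with finitely many values this is a computation with
independent Poisson counts; monotone approximation gives the rest.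

Conditionally on the locations, `SIR i > θ` is the event that an exponential variable exceeds a sum
of scaled independent exponential variables, which has probability `∏ j ≠ i, 1 / (1 + θ ℓ j / ℓ i)`.
For the closest station the event `∀ j, ‖x i‖ ≤ ‖x j‖` is again a product over `j`, so in both cases
the formula applies and only `∫ (1 - F)` over the plane is left; in polar coordinates it reduces to
`η(s, 1, 1) = 1 + ∫ u > 1, s / (s + u ^ (α / 2)) du`. Finally, when `θ ≥ 1` at most one station
has `SIR > θ`, so the coverage probability of the strongest station is the mean number of such
stations.
-/

section

open Filter Topology Set

/-- The function `y ↦ exp (-y)` on `[0, ∞]`, with value `0` at `∞`. -/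
noncomputable def expNeg (y : ℝ≥0∞) : ℝ≥0∞ := EReal.exp (-(y : EReal))

lemma continuous_expNeg : Continuous expNeg :=
  ENNReal.continuous_exp.comp (continuous_neg.comp continuous_coe_ennreal_ereal)

lemma expNeg_ofReal {y : ℝ} (hy : 0 ≤ y) :
    expNeg (ENNReal.ofReal y) = ENNReal.ofReal (Real.exp (-y)) := by
  rw [expNeg, EReal.coe_ennreal_ofReal, max_eq_left hy, ← EReal.coe_neg, EReal.exp_coe]

lemma expNeg_top : expNeg ∞ = 0 := by simp [expNeg]

lemma expNeg_zero : expNeg 0 = 1 := by simp [expNeg]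

lemma expNeg_le_one (y : ℝ≥0∞) : expNeg y ≤ 1 := by
  simpa [expNeg] using EReal.coe_ennreal_nonneg y

lemma expNeg_add (y z : ℝ≥0∞) : expNeg (y + z) = expNeg y * expNeg z := by
  rw [expNeg, EReal.coe_ennreal_add, EReal.neg_add (.inl (EReal.coe_ennreal_ne_bot _))
    (.inr (EReal.coe_ennreal_ne_bot _)), sub_eq_add_neg, EReal.exp_add, expNeg, expNeg]

lemma expNeg_sum {ι : Type*} (s : Finset ι) (y : ι → ℝ≥0∞) :
    expNeg (∑ j ∈ s, y j) = ∏ j ∈ s, expNeg (y j) := by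
  classical
  induction s using Finset.induction_on with
  | empty => simp [expNeg_zero]
  | insert a s ha ih => rw [Finset.sum_insert ha, Finset.prod_insert ha, expNeg_add, ih]

lemma expNeg_tsum {ι : Type*} (y : ι → ℝ≥0∞) : expNeg (∑' j, y j) = ∏' j, expNeg (y j) := by
  refine tendsto_nhds_unique ((continuous_expNeg.tendsto _).comp ENNReal.summable.hasSum) ?_
  simp only [Function.comp_def, expNeg_sum]
  exact (ENNReal.multipliable_of_le_one fun j => expNeg_le_one (y j)).hasProd

lemma tendsto_expNeg_lintegral_one_sub_of_antitone {E : Type*} [MeasurableSpace E]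
    {ν : Measure E} {f : ℕ → E → ℝ≥0∞} {f' : E → ℝ≥0∞}
    (hf : ∀ n, Measurable (f n)) (hanti : ∀ q, Antitone fun n => f n q)
    (hlim : ∀ q, Tendsto (fun n => f n q) atTop (𝓝 (f' q))) :
    Tendsto (fun n => expNeg (∫⁻ q, 1 - f n q ∂ν)) atTop (𝓝 (expNeg (∫⁻ q, 1 - f' q ∂ν))) :=
  (continuous_expNeg.tendsto _).comp <| lintegral_tendsto_of_tendsto_of_monotone
    (fun n => ((hf n).const_sub 1).aemeasurable)
    (.of_forall fun q _ _ hmn => tsub_le_tsub_left (hanti q hmn) 1)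
    (.of_forall fun q => ENNReal.Tendsto.sub tendsto_const_nhds (hlim q)
      (.inl ENNReal.one_ne_top))

section InfiniteProducts

variable {ι Ω : Type*}

lemma tendsto_tprod_of_antitone {f : ℕ → ι → ℝ≥0∞} {g : ι → ℝ≥0∞} (h1 : ∀ n i, f n i ≤ 1)
    (hf : ∀ i, Antitone fun n => f n i) (hlim : ∀ i, Tendsto (fun n => f n i) atTop (𝓝 (g i))) :
    Tendsto (fun n => ∏' i, f n i) atTop (𝓝 (∏' i, g i)) := by
  have hg1 : ∀ i, g i ≤ 1 := fun i => le_of_tendsto' (hlim i) fun n => h1 n i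
  have hprod : ∀ s : Finset ι, ∏ i ∈ s, g i = ⨅ n, ∏ i ∈ s, f n i := fun s =>
    tendsto_nhds_unique
      (ENNReal.tendsto_finsetProd_of_ne_top s (fun i _ => hlim i)
        fun i _ => (hg1 i).trans_lt ENNReal.one_lt_top |>.ne)
      (tendsto_atTop_iInf fun _ _ hmn => Finset.prod_le_prod' fun i _ => hf i hmn)
  have hanti : Antitone fun n => ∏' i, f n i := fun m n hmn =>
    (ENNReal.multipliable_of_le_one (h1 n)).tprod_le_tprod (fun i => hf i hmn)
      (ENNReal.multipliable_of_le_one (h1 m))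
  convert tendsto_atTop_iInf hanti
  simp only [ENNReal.tprod_eq_iInf_prod hg1, ENNReal.tprod_eq_iInf_prod (h1 _), hprod]
  exact iInf_comm

variable [Countable ι] [MeasurableSpace Ω] {P : Measure Ω}

lemma lintegral_tprod_of_iIndepFun {f : ι → Ω → ℝ≥0∞} (hf : ∀ i, Measurable (f i))
    (h1 : ∀ i ω, f i ω ≤ 1) (hind : iIndepFun f P) :
    ∫⁻ ω, ∏' i, f i ω ∂P = ∏' i, ∫⁻ ω, f i ω ∂P := by
  have := hind.isProbabilityMeasure
  have hint1 : ∀ i, ∫⁻ ω, f i ω ∂P ≤ 1 := fun i =>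
    (lintegral_mono (h1 i)).trans_eq (by simp)
  refine tendsto_nhds_unique ?_ (ENNReal.multipliable_of_le_one hint1).hasProd
  simp only [← lintegral_prod_eq_prod_lintegral_of_indepFun _ f hind hf]
  exact tendsto_lintegral_filter_of_dominated_convergence (fun _ => 1)
    (.of_forall fun s => Finset.measurable_fun_prod s fun i _ => hf i)
    (.of_forall fun s => .of_forall fun ω => Finset.prod_le_one' fun i _ => h1 i ω) (by simp)
    (.of_forall fun ω => (ENNReal.multipliable_of_le_one fun i => h1 i ω).hasProd)

lemma tendsto_lintegral_tsum_of_antitone {f : ℕ → ι → Ω → ℝ≥0∞} {g : ι → Ω → ℝ≥0∞}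
    (hf : ∀ n i, Measurable (f n i)) (hanti : ∀ i ω, Antitone fun n => f n i ω)
    (hfin : ∫⁻ ω, ∑' i, f 0 i ω ∂P ≠ ∞)
    (hlim : ∀ i ω, Tendsto (fun n => f n i ω) atTop (𝓝 (g i ω))) :
    Tendsto (fun n => ∫⁻ ω, ∑' i, f n i ω ∂P) atTop (𝓝 (∫⁻ ω, ∑' i, g i ω ∂P)) := by
  let _ : MeasurableSpace ι := ⊤
  have hg : ∀ i, Measurable (g i) := fun i =>
    measurable_of_tendsto_metrizable (hf · i) (tendsto_pi_nhds.2 (hlim i))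
  rw [lintegral_tsum fun i => (hf 0 i).aemeasurable] at hfin
  simp only [lintegral_tsum fun i => (hf _ i).aemeasurable,
    lintegral_tsum fun i => (hg i).aemeasurable]
  have hlint : ∀ i, Tendsto (fun n => ∫⁻ ω, f n i ω ∂P) atTop (𝓝 (∫⁻ ω, g i ω ∂P)) := fun i =>
    lintegral_tendsto_of_tendsto_of_antitone (fun n => (hf n i).aemeasurable)
      (.of_forall fun ω => hanti i ω) (ENNReal.ne_top_of_tsum_ne_top hfin i)
      (.of_forall fun ω => hlim i ω)
  simp only [← lintegral_count] at hfin ⊢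
  exact lintegral_tendsto_of_tendsto_of_antitone (fun n => measurable_from_top.aemeasurable)
    (.of_forall fun i _ _ hmn => lintegral_mono fun ω => hanti i ω hmn) hfin (.of_forall hlint)

end InfiniteProducts

/-! ### The Mecke formula for Poisson processes -/

section PoissonLaw

variable {Ω : Type*} [MeasurableSpace Ω] {P : Measure Ω} {m : ℝ≥0} {N : Ω → ℕ∞}

lemma lintegral_comp_of_hasLaw_poisson
    (hN : HasLaw N ((poissonMeasure m).map (fun n : ℕ => (n : ℕ∞))) P) (ψ : ℕ∞ → ℝ≥0∞) :
    ∫⁻ ω, ψ (N ω) ∂P = ∑' n : ℕ, ENNReal.ofReal (Real.exp (-m) * m ^ n / n.factorial) * ψ n := by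
  rw [hN.lintegral_comp Measurable.of_discrete.aemeasurable,
    lintegral_map Measurable.of_discrete Measurable.of_discrete, poissonMeasure,
    lintegral_sum_measure]
  simp [lintegral_smul_measure]

lemma ae_ne_top_of_hasLaw_poisson
    (hN : HasLaw N ((poissonMeasure m).map (fun n : ℕ => (n : ℕ∞))) P) : ∀ᵐ ω ∂P, N ω ≠ ⊤ := by
  rw [hN.ae_iff (p := (· ≠ ⊤)) Measurable.of_discrete,
    ae_map_iff Measurable.of_discrete.aemeasurable .of_discrete]
  simp

lemma lintegral_pow_of_hasLaw_poisson
    (hN : HasLaw N ((poissonMeasure m).map (fun n : ℕ => (n : ℕ∞))) P) {c : ℝ≥0∞} (hc : c ≤ 1) :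
    ∫⁻ ω, c ^ (N ω).toNat ∂P = expNeg (m * (1 - c)) := by
  lift c to ℝ≥0 using ne_top_of_le_ne_top ENNReal.one_ne_top hc
  have hc' : (c : ℝ) ≤ 1 := by exact_mod_cast hc
  have hexp : HasSum (fun n : ℕ => Real.exp (-m) * m ^ n / n.factorial * c ^ n)
      (Real.exp (-(m * (1 - c)))) := by
    have h := (NormedSpace.expSeries_div_hasSum_exp ((m : ℝ) * c)).mul_left (Real.exp (-m))
    rw [← Real.exp_eq_exp_ℝ, ← Real.exp_add, show -(m : ℝ) + m * c = -(m * (1 - c)) by ring] at h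
    exact h.congr_fun fun n => by rw [mul_pow]; ring
  have hR : (m : ℝ≥0∞) * (1 - c) = ENNReal.ofReal (m * (1 - c)) := by
    rw [ENNReal.ofReal_mul m.coe_nonneg, ENNReal.ofReal_sub _ c.coe_nonneg]
    simp
  rw [lintegral_comp_of_hasLaw_poisson hN (fun n => c ^ n.toNat), hR,
    expNeg_ofReal (mul_nonneg m.coe_nonneg (sub_nonneg.2 hc')), ← hexp.tsum_eq,
    ENNReal.ofReal_tsum_of_nonneg (fun n => by positivity) hexp.summable]
  refine tsum_congr fun n => ?_
  rw [ENNReal.ofReal_mul (by positivity), ENNReal.ofReal_pow c.coe_nonneg,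
    ENNReal.ofReal_coe_nnreal, ENat.toNat_natCast]

lemma lintegral_mul_pow_pred_of_hasLaw_poisson
    (hN : HasLaw N ((poissonMeasure m).map (fun n : ℕ => (n : ℕ∞))) P) {c : ℝ≥0∞} (hc : c ≤ 1) :
    ∫⁻ ω, N ω * c ^ ((N ω).toNat - 1) ∂P = m * expNeg (m * (1 - c)) := by
  rw [← lintegral_pow_of_hasLaw_poisson hN hc,
    lintegral_comp_of_hasLaw_poisson hN (fun n => n * c ^ (n.toNat - 1)),
    lintegral_comp_of_hasLaw_poisson hN (fun n => c ^ n.toNat),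
    tsum_eq_zero_add' ENNReal.summable, ← ENNReal.tsum_mul_left]
  simp only [Nat.cast_zero, ENat.toENNReal_zero, zero_mul, mul_zero, zero_add, ENat.toNat_natCast,
    Nat.add_sub_cancel, ENat.toENNReal_coe]
  refine tsum_congr fun n => ?_
  rw [← mul_assoc, ← mul_assoc, ← ENNReal.ofReal_natCast, ← ENNReal.ofReal_coe_nnreal,
    ← ENNReal.ofReal_mul (by positivity), ← ENNReal.ofReal_mul (by positivity)]
  congr 2
  rw [Nat.factorial_succ, pow_succ]
  push_cast
  field_simp

end PoissonLaw

section Cells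

variable {I β : Type*} [DecidableEq β] {κ : I → β} {R : Finset β}

lemma tprod_ne_comp_eq_prod_pow {M : Type*} [CommMonoid M] [TopologicalSpace M] {f : β → M}
    (hfin : ∀ b ∈ R, {i | κ i = b}.Finite) (hf : ∀ i, κ i ∉ R → f (κ i) = 1) {i : I}
    (hi : κ i ∈ R) :
    ∏' j : {j // j ≠ i}, f (κ j) =
      ∏ b ∈ R, f b ^ (if b = κ i then {j | κ j = b}.ncard - 1 else {j | κ j = b}.ncard) := by
  classical
  have hJfin : {j | κ j ∈ R}.Finite :=
    (R.finite_toSet.biUnion hfin).subset fun j hj => mem_biUnion hj rfl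
  set J := hJfin.toFinset with hJ
  have hcard : ∀ b ∈ R, {j | κ j = b}.ncard = (J.filter (κ · = b)).card := fun b hb => by
    rw [← ncard_coe_finset]
    congr 1
    ext j
    simp only [hJ, mem_ofPred_eq, Finset.coe_filter, Finite.mem_toFinset]
    exact ⟨fun h => ⟨h ▸ hb, h⟩, And.right⟩
  have hfinite : ∏' j : {j // j ≠ i}, f (κ j) = ∏ j ∈ J.erase i, f (κ j) := by
    refine (tprod_subtype {j | j ≠ i} fun j => f (κ j)).trans ?_
    rw [tprod_eq_prod (s := J.erase i)]
    · exact Finset.prod_congr rfl fun j hj => mulIndicator_of_mem (Finset.ne_of_mem_erase hj) _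
    · intro j hj
      by_cases h : j = i
      · simp [h]
      · rw [mulIndicator_of_mem h, hf j fun hR => hj (by simp [hJ, h, hR])]
  rw [hfinite, ← Finset.prod_fiberwise_of_maps_to (t := R) (g := κ)
    (fun j hj => by simpa [hJ] using Finset.mem_of_mem_erase hj)]
  refine Finset.prod_congr rfl fun b hb => ?_
  rw [Finset.prod_congr rfl (g := fun _ => f b) fun j hj => by rw [(Finset.mem_filter.1 hj).2],
    Finset.prod_const, Finset.filter_erase, hcard b hb]
  split_ifs with h
  · rw [Finset.card_erase_of_mem (by simp [hJ, h, hi])]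
  · rw [Finset.erase_eq_of_notMem (by simp [Ne.symm h])]

lemma tsum_indicator_tprod_ne_eq_prod {f : β → ℝ≥0∞} (hfin : ∀ b ∈ R, {i | κ i = b}.Finite)
    (hf : ∀ i, κ i ∉ R → f (κ i) = 1) {k : β} (hk : k ∈ R) :
    ∑' i, {i | κ i = k}.indicator (fun i => ∏' j : {j // j ≠ i}, f (κ j)) i =
      ∏ b ∈ R, if b = k then {i | κ i = b}.encard * f b ^ ({i | κ i = b}.encard.toNat - 1)
        else f b ^ {i | κ i = b}.encard.toNat := by
  rw [← tsum_subtype {i | κ i = k} (fun i => ∏' j : {j // j ≠ i}, f (κ j)),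
    tsum_congr fun i : {i | κ i = k} =>
      (tprod_ne_comp_eq_prod_pow hfin hf (i.2.symm ▸ hk : κ i ∈ R)).trans
        (Finset.prod_congr rfl fun b _ => by rw [show κ i = k from i.2]),
    ENNReal.tsum_set_const, ← Finset.mul_prod_erase _ _ hk, ← Finset.mul_prod_erase _ _ hk,
    if_pos rfl, if_pos rfl, ← mul_assoc]
  congr 1
  refine Finset.prod_congr rfl fun b hb => ?_
  rw [if_neg (Finset.ne_of_mem_erase hb), if_neg (Finset.ne_of_mem_erase hb)]
  rfl

end Cells

/-- The random points `X i`, `i : I`, form a Poisson point process with intensity measure `ν`. The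
counts of the measurable sets of finite intensity are Poisson distributed, and independent for
disjoint sets; the points are enumerated in an arbitrary way and may coincide. -/
structure IsPPP {Ω E I : Type*} [MeasurableSpace Ω] [MeasurableSpace E] (P : Measure Ω)
    (ν : Measure E) (X : I → Ω → E) : Prop where
  measurable_point : ∀ i, Measurable (X i)
  count_law : ∀ B : Set E, MeasurableSet B → ν B < ∞ →
    HasLaw (fun ω => {i | X i ω ∈ B}.encard)
      ((poissonMeasure (ν B).toNNReal).map (fun n : ℕ => (n : ℕ∞))) P
  count_indep : ∀ (n : ℕ) (B : Fin n → Set E), (∀ j, MeasurableSet (B j)) → (∀ j, ν (B j) < ∞) →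
    Pairwise (fun j k => Disjoint (B j) (B k)) →
    iIndepFun (fun j ω => {i | X i ω ∈ B j}.encard) P

lemma lintegral_comp_eq_sum_fibers {E β : Type*} [MeasurableSpace E] {ν : Measure E} {κ : E → β}
    {R : Finset β} (hκ : ∀ b ∈ R, MeasurableSet (κ ⁻¹' {b})) {f : β → ℝ≥0∞}
    (hf : ∀ p, κ p ∉ R → f (κ p) = 0) :
    ∫⁻ p, f (κ p) ∂ν = ∑ b ∈ R, ν (κ ⁻¹' {b}) * f b := by
  classical
  have hsum : ∀ p, f (κ p) = ∑ b ∈ R, (κ ⁻¹' {b}).indicator (fun _ => f b) p := fun p => by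
    by_cases h : κ p ∈ R <;> simp [indicator, h, hf]
  rw [lintegral_congr hsum,
    lintegral_finsetSum' R fun b hb => (measurable_const.indicator (hκ b hb)).aemeasurable]
  exact Finset.sum_congr rfl fun b hb => by rw [lintegral_indicator_const (hκ b hb), mul_comm]

namespace IsPPP

variable {Ω E I : Type*} [MeasurableSpace Ω] [MeasurableSpace E] {P : Measure Ω} {ν : Measure E}
  {X : I → Ω → E}

lemma iIndepFun_count (hX : IsPPP P ν X) {ι : Type*} [Finite ι] {B : ι → Set E}
    (hB : ∀ j, MeasurableSet (B j)) (hν : ∀ j, ν (B j) < ∞)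
    (hdisj : Pairwise fun j k => Disjoint (B j) (B k)) :
    iIndepFun (fun j ω => {i | X i ω ∈ B j}.encard) P := by
  obtain ⟨n, ⟨e⟩⟩ := Finite.exists_equiv_fin ι
  simpa using (hX.count_indep n (fun k => B (e.symm k)) (fun _ => hB _) (fun _ => hν _)
    fun j k hjk => hdisj (e.symm.injective.ne hjk)).precomp e.injective

lemma isProbabilityMeasure (hX : IsPPP P ν X) : IsProbabilityMeasure P :=
  (hX.count_indep 0 Fin.elim0 (fun j => j.elim0) (fun j => j.elim0)
    fun j => j.elim0).isProbabilityMeasure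

lemma ae_finite (hX : IsPPP P ν X) {A : Set E} (hA : MeasurableSet A) (hνA : ν A < ∞) :
    ∀ᵐ ω ∂P, {i | X i ω ∈ A}.Finite :=
  (ae_ne_top_of_hasLaw_poisson (hX.count_law A hA hνA)).mono fun _ => encard_ne_top_iff.1

variable [Countable I]

lemma measurable_count (hX : IsPPP P ν X) {B : Set E} (hB : MeasurableSet B) :
    Measurable fun ω => {i | X i ω ∈ B}.encard :=
  measurable_encard.comp <| measurable_set_iff.2 fun i =>
    measurable_to_prop (by simpa [preimage] using hX.measurable_point i hB)

lemma measurable_indicator_mul_tprod_ne_uncurry (hX : IsPPP P ν X) {A : Set E}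
    (hA : MeasurableSet A) {K : E → E → ℝ≥0∞} (hK : Measurable K.uncurry) (i : I) :
    Measurable fun ω => A.indicator 1 (X i ω) * ∏' j : {j // j ≠ i}, K (X i ω) (X j ω) :=
  ((measurable_one.indicator hA).comp (hX.measurable_point i)).mul
    (.tprod fun j => hK.comp ((hX.measurable_point i).prodMk (hX.measurable_point j)))

lemma measurable_indicator_mul_tprod_ne (hX : IsPPP P ν X) {A : Set E}
    (hA : MeasurableSet A) {u : E → ℝ≥0∞} (hu : Measurable u) (i : I) :
    Measurable fun ω => A.indicator 1 (X i ω) * ∏' j : {j // j ≠ i}, u (X j ω) :=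
  hX.measurable_indicator_mul_tprod_ne_uncurry hA (K := fun _ => u) (hu.comp measurable_snd) i

lemma lintegral_tsum_fiber_mul_tprod_ne (hX : IsPPP P ν X) {β : Type*}
    {κ : E → β} {R : Finset β} (hκ : ∀ b ∈ R, MeasurableSet (κ ⁻¹' {b}))
    (hν : ∀ b ∈ R, ν (κ ⁻¹' {b}) < ∞) {f : β → ℝ≥0∞} (hf1 : ∀ b, f b ≤ 1)
    (hf : ∀ p, κ p ∉ R → f (κ p) = 1) {k : β} (hk : k ∈ R) :
    ∫⁻ ω, ∑' i, (κ ⁻¹' {k}).indicator 1 (X i ω) * ∏' j : {j // j ≠ i}, f (κ (X j ω)) ∂P =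
      ν (κ ⁻¹' {k}) * expNeg (∫⁻ p, 1 - f (κ p) ∂ν) := by
  classical
  let N (b : β) (ω : Ω) : ℕ∞ := {i | κ (X i ω) = b}.encard
  let ψ (b : β) (n : ℕ∞) : ℝ≥0∞ := if b = k then n * f b ^ (n.toNat - 1) else f b ^ n.toNat
  have hN : ∀ b ∈ R, HasLaw (N b)
      ((poissonMeasure (ν (κ ⁻¹' {b})).toNNReal).map (fun n : ℕ => (n : ℕ∞))) P := fun b hb =>
    hX.count_law _ (hκ b hb) (hν b hb)
  have hind : iIndepFun (fun b : R => N b) P :=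
    hX.iIndepFun_count (B := fun b : R => κ ⁻¹' {b.1}) (fun b => hκ b b.2) (fun b => hν b b.2)
      fun b c hbc => Disjoint.preimage κ (disjoint_singleton.2 (Subtype.coe_injective.ne hbc))
  have hfin : ∀ᵐ ω ∂P, ∀ b ∈ R, {i | κ (X i ω) = b}.Finite := by
    rw [eventually_all_finset]
    exact fun b hb => hX.ae_finite (hκ b hb) (hν b hb)
  have hprod : ∀ᵐ ω ∂P, ∑' i, (κ ⁻¹' {k}).indicator 1 (X i ω) *
      ∏' j : {j // j ≠ i}, f (κ (X j ω)) = ∏ b : R, ψ b (N b ω) :=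
    hfin.mono fun ω hω => by
      rw [Finset.prod_coe_sort R fun b => ψ b (N b ω),
        ← tsum_indicator_tprod_ne_eq_prod hω (fun i => hf (X i ω)) hk]
      exact tsum_congr fun i => by simp [indicator_apply]
  have hE : ∀ b ∈ R, ∫⁻ ω, ψ b (N b ω) ∂P =
      (if b = k then ν (κ ⁻¹' {b}) else 1) * expNeg (ν (κ ⁻¹' {b}) * (1 - f b)) := fun b hb => by
    rw [← ENNReal.coe_toNNReal (hν b hb).ne]
    simp only [ψ]
    split_ifs with h
    · exact lintegral_mul_pow_pred_of_hasLaw_poisson (hN b hb) (hf1 b)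
    · rw [one_mul]
      exact lintegral_pow_of_hasLaw_poisson (hN b hb) (hf1 b)
  have hint := lintegral_comp_eq_sum_fibers hκ (ν := ν) (f := fun b => 1 - f b)
    fun p hp => by rw [hf p hp, tsub_self]
  rw [lintegral_congr_ae hprod, lintegral_prod_eq_prod_lintegral_of_indepFun _
    (fun (b : R) ω => ψ b (N b ω)) (hind.comp (fun b => ψ b) fun b => .of_discrete)
    (fun b => (Measurable.of_discrete : Measurable (ψ b)).comp (hX.measurable_count (hκ b b.2))),
    Finset.prod_coe_sort R fun b => ∫⁻ ω, ψ b (N b ω) ∂P, Finset.prod_congr rfl hE,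
    Finset.prod_mul_distrib, hint, expNeg_sum, Finset.prod_ite_eq_of_mem' _ _ _ hk]

end IsPPP

section SimpleFunctions

variable {E : Type*} [MeasurableSpace E] {ν : Measure E}

lemma indicator_mul_comp_simpleFunc_eq_sum {T : Type*} (τ : SimpleFunc E T) (A : Set E)
    (g : T → ℝ≥0∞) (p : E) :
    A.indicator 1 p * g (τ p) = ∑ k ∈ τ.range, (A ∩ τ ⁻¹' {k}).indicator 1 p * g k := by
  rw [Finset.sum_eq_single_of_mem (τ p) (τ.mem_range_self p)]
  · by_cases h : p ∈ A <;> simp [h]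
  · intro k _ hk
    simp [hk.symm]

lemma exists_simpleFunc_seq_finite_support_tendsto [SigmaFinite ν] {w : E → ℝ≥0∞}
    (hw : Measurable w) :
    ∃ v : ℕ → SimpleFunc E ℝ≥0∞, Monotone v ∧ (∀ n, ν (Function.support (v n)) < ∞) ∧
      ∀ p, Tendsto (fun n => v n p) atTop (𝓝 (w p)) := by
  have happly : ∀ n p, (SimpleFunc.eapprox w n).restrict (spanningSets ν n) p =
      (spanningSets ν n).indicator (SimpleFunc.eapprox w n) p := fun n =>
    SimpleFunc.restrict_apply _ (measurableSet_spanningSets ν n)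
  refine ⟨fun n => (SimpleFunc.eapprox w n).restrict (spanningSets ν n), fun m n hmn p => ?_,
    fun n => ?_, fun p => ?_⟩
  · simp only [happly]
    exact (indicator_le_indicator (SimpleFunc.monotone_eapprox w hmn p)).trans
      (indicator_le_indicator_of_subset (monotone_spanningSets ν hmn) (fun _ => zero_le) p)
  · refine (measure_mono fun p hp => ?_).trans_lt (measure_spanningSets_lt_top ν n)
    rw [Function.mem_support, happly] at hp
    exact mem_of_indicator_ne_zero hp
  · refine (SimpleFunc.tendsto_eapprox hw p).congr' ?_
    filter_upwards [eventually_mem_spanningSets ν p] with n hn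
    rw [happly, indicator_of_mem hn]

lemma exists_simpleFunc_seq_nnreal_tendsto {ρ : E → ℝ≥0} (hρ : Measurable ρ) :
    ∃ τ : ℕ → SimpleFunc E ℝ≥0, Monotone τ ∧ (∀ n p, τ n p ≤ ρ p) ∧
      ∀ p, Tendsto (fun n => τ n p) atTop (𝓝 (ρ p)) := by
  have hw : Measurable fun p => (ρ p : ℝ≥0∞) := hρ.coe_nnreal_ennreal
  have hmono := SimpleFunc.monotone_eapprox fun p => (ρ p : ℝ≥0∞)
  have hlim : ∀ p, Tendsto (fun n => (SimpleFunc.eapprox (fun p => (ρ p : ℝ≥0∞)) n p).toNNReal)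
      atTop (𝓝 (ρ p)) := fun p =>
    (ENNReal.tendsto_toNNReal ENNReal.coe_ne_top).comp (SimpleFunc.tendsto_eapprox hw p)
  have hanti : ∀ p, Monotone fun n =>
      (SimpleFunc.eapprox (fun p => (ρ p : ℝ≥0∞)) n p).toNNReal := fun p m n hmn =>
    ENNReal.toNNReal_mono (SimpleFunc.eapprox_lt_top _ n p).ne (hmono hmn p)
  exact ⟨fun n => (SimpleFunc.eapprox (fun p => (ρ p : ℝ≥0∞)) n).map ENNReal.toNNReal,
    fun m n hmn p => hanti p hmn, fun n p => (hanti p).ge_of_tendsto (hlim p) n, hlim⟩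

end SimpleFunctions

namespace IsPPP

variable {Ω E I : Type*} [MeasurableSpace Ω] [MeasurableSpace E] {P : Measure Ω} {ν : Measure E}
  {X : I → Ω → E} [Countable I]

lemma lintegral_tsum_indicator_mul_tprod_ne_simpleFunc (hX : IsPPP P ν X) {A : Set E}
    (hA : MeasurableSet A) (hνA : ν A < ∞) (v : SimpleFunc E ℝ≥0∞) (hv1 : ∀ p, v p ≤ 1)
    (hv : ν (Function.support v) < ∞) :
    ∫⁻ ω, ∑' i, A.indicator 1 (X i ω) * ∏' j : {j // j ≠ i}, (1 - v (X j ω)) ∂P =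
      ν A * expNeg (∫⁻ p, v p ∂ν) := by
  classical
  let κ : E → Prop × ℝ≥0∞ := fun p => (p ∈ A, v p)
  let R : Finset (Prop × ℝ≥0∞) := (Finset.univ ×ˢ v.range).filter fun b => b.1 ∨ b.2 ≠ 0
  have hκ : ∀ b ∈ R, MeasurableSet (κ ⁻¹' {b}) := fun b _ =>
    (hA.mem.prodMk v.measurable) (measurableSet_singleton b)
  have hνκ : ∀ b ∈ R, ν (κ ⁻¹' {b}) < ∞ := by
    rintro b hb
    refine (measure_mono fun p (hp : κ p = b) => ?_).trans_lt
      ((measure_union_le A (Function.support v)).trans_lt (ENNReal.add_lt_top.2 ⟨hνA, hv⟩))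
    simpa [← hp, κ] using (Finset.mem_filter.1 hb).2
  have hfiber : ∀ c ∈ v.range, ∫⁻ ω, ∑' i, (A ∩ v ⁻¹' {c}).indicator 1 (X i ω) *
      ∏' j : {j // j ≠ i}, (1 - v (X j ω)) ∂P = ν (A ∩ v ⁻¹' {c}) * expNeg (∫⁻ p, v p ∂ν) := by
    intro c hc
    have hset : κ ⁻¹' {(True, c)} = A ∩ v ⁻¹' {c} := by ext p; simp [κ]
    have := hX.lintegral_tsum_fiber_mul_tprod_ne hκ hνκ (f := fun b => 1 - b.2)
      (fun b => tsub_le_self) (k := (True, c)) (fun p hp => ?_) (by simpa [R] using hc)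
    · simpa only [hset, κ, ENNReal.sub_sub_cancel ENNReal.one_ne_top (hv1 _)] using this
    · have hvp : v p = 0 := by
        by_contra hne
        exact hp (Finset.mem_filter.2
          ⟨Finset.mk_mem_product (Finset.mem_univ _) (v.mem_range_self p), .inr hne⟩)
      simp [κ, hvp]
  have hsplit : ∀ ω i, A.indicator 1 (X i ω) * ∏' j : {j // j ≠ i}, (1 - v (X j ω)) =
      ∑ c ∈ v.range, (A ∩ v ⁻¹' {c}).indicator 1 (X i ω) *
        ∏' j : {j // j ≠ i}, (1 - v (X j ω)) := fun ω i =>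
    indicator_mul_comp_simpleFunc_eq_sum v A (fun _ => ∏' j : {j // j ≠ i}, (1 - v (X j ω))) _
  have hmeas : ∀ c i, Measurable fun ω => (A ∩ v ⁻¹' {c}).indicator 1 (X i ω) *
      ∏' j : {j // j ≠ i}, (1 - v (X j ω)) := fun c =>
    hX.measurable_indicator_mul_tprod_ne (hA.inter (v.measurableSet_fiber c))
      (v.measurable.const_sub 1)
  simp only [hsplit, Summable.tsum_finsetSum fun _ _ => ENNReal.summable]
  rw [lintegral_finsetSum _ fun c _ => .tsum (hmeas c), Finset.sum_congr rfl hfiber,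
    ← Finset.sum_mul]
  congr 1
  simpa [Measure.restrict_apply (v.measurableSet_fiber _), inter_comm] using
    v.sum_range_measure_preimage_singleton (ν.restrict A)

lemma lintegral_tsum_indicator (hX : IsPPP P ν X) {A : Set E} (hA : MeasurableSet A)
    (hνA : ν A < ∞) : ∫⁻ ω, ∑' i, A.indicator 1 (X i ω) ∂P = ν A := by
  simpa [expNeg_zero] using
    hX.lintegral_tsum_indicator_mul_tprod_ne_simpleFunc hA hνA 0 (by simp) (by simp)

lemma lintegral_tsum_indicator_mul_tprod_ne (hX : IsPPP P ν X) [SigmaFinite ν]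
    {A : Set E} (hA : MeasurableSet A) (hνA : ν A < ∞) {u : E → ℝ≥0∞} (hu : Measurable u)
    (hu1 : ∀ p, u p ≤ 1) :
    ∫⁻ ω, ∑' i, A.indicator 1 (X i ω) * ∏' j : {j // j ≠ i}, u (X j ω) ∂P =
      ν A * expNeg (∫⁻ p, 1 - u p ∂ν) := by
  obtain ⟨v, hmono, hsupp, hlim⟩ :=
    exists_simpleFunc_seq_finite_support_tendsto (ν := ν) (hu.const_sub 1)
  have hv1 : ∀ n p, v n p ≤ 1 := fun n p =>
    (Monotone.ge_of_tendsto (fun _ _ hmn => hmono hmn p) (hlim p) n).trans tsub_le_self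
  have hvu : ∀ p, Tendsto (fun n => 1 - v n p) atTop (𝓝 (u p)) := fun p => by
    simpa [ENNReal.sub_sub_cancel ENNReal.one_ne_top (hu1 p)] using
      ENNReal.Tendsto.sub tendsto_const_nhds (hlim p) (.inl ENNReal.one_ne_top)
  have hprod_anti : ∀ i ω, Antitone fun n =>
      A.indicator 1 (X i ω) * ∏' j : {j // j ≠ i}, (1 - v n (X j ω)) := fun i ω m n hmn =>
    mul_le_mul' le_rfl ((ENNReal.multipliable_of_le_one fun _ => tsub_le_self).tprod_le_tprod
      (fun j => tsub_le_tsub_left (hmono hmn (X j ω)) 1)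
      (ENNReal.multipliable_of_le_one fun _ => tsub_le_self))
  have hl : Tendsto (fun n => ∫⁻ ω, ∑' i, A.indicator 1 (X i ω) *
      ∏' j : {j // j ≠ i}, (1 - v n (X j ω)) ∂P) atTop
      (𝓝 (∫⁻ ω, ∑' i, A.indicator 1 (X i ω) * ∏' j : {j // j ≠ i}, u (X j ω) ∂P)) := by
    refine tendsto_lintegral_tsum_of_antitone
      (fun n => hX.measurable_indicator_mul_tprod_ne hA ((v n).measurable.const_sub 1))
      hprod_anti ?_ fun i ω => ?_
    · rw [hX.lintegral_tsum_indicator_mul_tprod_ne_simpleFunc hA hνA _ (hv1 0) (hsupp 0)]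
      exact ENNReal.mul_ne_top hνA.ne ((expNeg_le_one _).trans_lt ENNReal.one_lt_top).ne
    · refine ENNReal.Tendsto.const_mul (tendsto_tprod_of_antitone (fun _ _ => tsub_le_self)
        (fun j m n hmn => tsub_le_tsub_left (hmono hmn _) 1) fun j => hvu _) (.inr ?_)
      by_cases h : X i ω ∈ A <;> simp [h]
  have hr : Tendsto (fun n => ν A * expNeg (∫⁻ p, v n p ∂ν)) atTop
      (𝓝 (ν A * expNeg (∫⁻ p, 1 - u p ∂ν))) :=
    ENNReal.Tendsto.const_mul ((continuous_expNeg.tendsto _).comp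
      (lintegral_tendsto_of_tendsto_of_monotone (fun n => (v n).measurable.aemeasurable)
        (.of_forall fun p m n hmn => hmono hmn p) (.of_forall hlim))) (.inr hνA.ne)
  refine tendsto_nhds_unique hl (hr.congr fun n => ?_)
  exact (hX.lintegral_tsum_indicator_mul_tprod_ne_simpleFunc hA hνA _ (hv1 n) (hsupp n)).symm

end IsPPP

section SimpleApproximation

variable {E : Type*} [MeasurableSpace E] {F : ℝ≥0 → E → ℝ≥0∞}

lemma measurable_uncurry_comp_simpleFunc {E' : Type*} [MeasurableSpace E'] {T : Type*}
    (τ : SimpleFunc E' T) {G : T → E → ℝ≥0∞} (hG : ∀ t, Measurable (G t)) :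
    Measurable (Function.uncurry fun p q => G (τ p) q) :=
  (τ.comp Prod.fst measurable_fst).measurable_bind (fun t z => G t z.2)
    fun t => (hG t).comp measurable_snd

lemma measurable_uncurry_comp_of_continuousWithinAt_Iic {E' : Type*} [MeasurableSpace E']
    {ρ : E' → ℝ≥0} (hρ : Measurable ρ) (hF : ∀ s, Measurable (F s))
    (hcont : ∀ q s, ContinuousWithinAt (fun s => F s q) (Iic s) s) :
    Measurable (Function.uncurry fun p q => F (ρ p) q) := by
  obtain ⟨τ, -, hle, hlim⟩ := exists_simpleFunc_seq_nnreal_tendsto hρ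
  exact measurable_of_tendsto_metrizable
    (fun n => measurable_uncurry_comp_simpleFunc (τ n) hF)
    (tendsto_pi_nhds.2 fun z => (hcont z.2 (ρ z.1)).tendsto.comp
      (tendsto_nhdsWithin_iff.2 ⟨hlim z.1, .of_forall fun n => hle n z.1⟩))

end SimpleApproximation

namespace IsPPP

variable {Ω E I : Type*} [MeasurableSpace Ω] [MeasurableSpace E] {P : Measure Ω} {ν : Measure E}
  {X : I → Ω → E} [Countable I] [SigmaFinite ν]

lemma lintegral_tsum_indicator_mul_tprod_ne_comp_simpleFunc (hX : IsPPP P ν X)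
    {T : Type*} {A : Set E} (hA : MeasurableSet A) (hνA : ν A < ∞) (τ : SimpleFunc E T)
    {G : T → E → ℝ≥0∞} (hG : ∀ t, Measurable (G t)) (hG1 : ∀ t p, G t p ≤ 1) :
    ∫⁻ ω, ∑' i, A.indicator 1 (X i ω) * ∏' j : {j // j ≠ i}, G (τ (X i ω)) (X j ω) ∂P =
      ∫⁻ p in A, expNeg (∫⁻ q, 1 - G (τ p) q ∂ν) ∂ν := by
  have hfiber : ∀ t, MeasurableSet (A ∩ τ ⁻¹' {t}) := fun t => hA.inter (τ.measurableSet_fiber t)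
  simp only [fun ω i => indicator_mul_comp_simpleFunc_eq_sum τ A
    (fun t => ∏' j : {j // j ≠ i}, G t (X j ω)) (X i ω),
    Summable.tsum_finsetSum fun _ _ => ENNReal.summable]
  rw [lintegral_finsetSum _ fun t _ =>
      .tsum fun i => hX.measurable_indicator_mul_tprod_ne (hfiber t) (hG t) i,
    lintegral_comp_eq_sum_fibers (ν := ν.restrict A) (R := τ.range)
      (fun t _ => τ.measurableSet_fiber t) (f := fun t => expNeg (∫⁻ q, 1 - G t q ∂ν))
      fun p hp => absurd (τ.mem_range_self p) hp]
  refine Finset.sum_congr rfl fun t _ => ?_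
  rw [hX.lintegral_tsum_indicator_mul_tprod_ne (hfiber t)
      ((measure_mono inter_subset_left).trans_lt hνA) (hG t) (hG1 t),
    Measure.restrict_apply (τ.measurableSet_fiber t), inter_comm]

section Mecke

variable {ρ : E → ℝ≥0} {F : ℝ≥0 → E → ℝ≥0∞}

lemma lintegral_tsum_indicator_mul_tprod_ne_comp (hX : IsPPP P ν X) (hρ : Measurable ρ)
    (hF : ∀ s, Measurable (F s)) (hF1 : ∀ s q, F s q ≤ 1) (hanti : ∀ q, Antitone fun s => F s q)
    (hcont : ∀ q s, ContinuousWithinAt (fun s => F s q) (Iic s) s)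
    {A : Set E} (hA : MeasurableSet A) (hνA : ν A < ∞) :
    ∫⁻ ω, ∑' i, A.indicator 1 (X i ω) * ∏' j : {j // j ≠ i}, F (ρ (X i ω)) (X j ω) ∂P =
      ∫⁻ p in A, expNeg (∫⁻ q, 1 - F (ρ p) q ∂ν) ∂ν := by
  obtain ⟨τ, hmono, hle, hlim⟩ := exists_simpleFunc_seq_nnreal_tendsto hρ
  have hFanti : ∀ p q, Antitone fun n => F (τ n p) q := fun p q m n hmn =>
    hanti q (hmono hmn p)
  have hFlim : ∀ p q, Tendsto (fun n => F (τ n p) q) atTop (𝓝 (F (ρ p) q)) := fun p q =>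
    (hcont q (ρ p)).tendsto.comp
      (tendsto_nhdsWithin_iff.2 ⟨hlim p, .of_forall fun n => hle n p⟩)
  have hl : Tendsto (fun n => ∫⁻ ω, ∑' i, A.indicator 1 (X i ω) *
      ∏' j : {j // j ≠ i}, F (τ n (X i ω)) (X j ω) ∂P) atTop
      (𝓝 (∫⁻ ω, ∑' i, A.indicator 1 (X i ω) *
        ∏' j : {j // j ≠ i}, F (ρ (X i ω)) (X j ω) ∂P)) := by
    refine tendsto_lintegral_tsum_of_antitone
      (fun n => hX.measurable_indicator_mul_tprod_ne_uncurry hA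
        (measurable_uncurry_comp_simpleFunc (τ n) hF))
      (fun i ω m n hmn => mul_le_mul' le_rfl
        ((ENNReal.multipliable_of_le_one fun _ => hF1 _ _).tprod_le_tprod
          (fun j => hFanti (X i ω) (X j ω) hmn)
          (ENNReal.multipliable_of_le_one fun _ => hF1 _ _))) ?_ fun i ω => ?_
    · refine ((lintegral_mono fun ω => ENNReal.tsum_le_tsum fun i =>
        mul_le_of_le_one_right' ?_).trans_lt ((hX.lintegral_tsum_indicator hA hνA).trans_lt hνA)).ne
      exact tprod_le_one fun _ => hF1 _ _
    · refine ENNReal.Tendsto.const_mul (tendsto_tprod_of_antitone (fun _ _ => hF1 _ _)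
        (fun j => hFanti _ _) fun j => hFlim _ _) (.inr ?_)
      by_cases h : X i ω ∈ A <;> simp [h]
  have hr : Tendsto (fun n => ∫⁻ p in A, expNeg (∫⁻ q, 1 - F (τ n p) q ∂ν) ∂ν) atTop
      (𝓝 (∫⁻ p in A, expNeg (∫⁻ q, 1 - F (ρ p) q ∂ν) ∂ν)) :=
    tendsto_lintegral_of_dominated_convergence 1
      (fun n => ((τ n).map fun t => expNeg (∫⁻ q, 1 - F t q ∂ν)).measurable)
      (fun n => .of_forall fun p => expNeg_le_one _) (by simpa using hνA.ne)
      (.of_forall fun p =>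
        tendsto_expNeg_lintegral_one_sub_of_antitone (fun n => hF _) (hFanti p) (hFlim p))
  refine tendsto_nhds_unique hl (hr.congr fun n => ?_)
  exact (hX.lintegral_tsum_indicator_mul_tprod_ne_comp_simpleFunc hA hνA (τ n) hF hF1).symm

theorem lintegral_tsum_tprod_ne (hX : IsPPP P ν X) (hρ : Measurable ρ)
    (hF : ∀ s, Measurable (F s)) (hF1 : ∀ s q, F s q ≤ 1) (hanti : ∀ q, Antitone fun s => F s q)
    (hcont : ∀ q s, ContinuousWithinAt (fun s => F s q) (Iic s) s) :
    ∫⁻ ω, ∑' i, ∏' j : {j // j ≠ i}, F (ρ (X i ω)) (X j ω) ∂P =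
      ∫⁻ p, expNeg (∫⁻ q, 1 - F (ρ p) q ∂ν) ∂ν := by
  have hK := measurable_uncurry_comp_of_continuousWithinAt_Iic hρ hF hcont
  let D : ℕ → Set E := disjointed (spanningSets ν)
  have hD : ∀ n, MeasurableSet (D n) := .disjointed (measurableSet_spanningSets ν)
  have hνD : ∀ n, ν (D n) < ∞ := fun n =>
    (measure_mono (disjointed_subset _ n)).trans_lt (measure_spanningSets_lt_top ν n)
  have hDuniv : ⋃ n, D n = univ := by rw [iUnion_disjointed, iUnion_spanningSets]
  have hsum : ∀ i ω (c : ℝ≥0∞), c = ∑' n, (D n).indicator 1 (X i ω) * c := fun i ω c => by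
    obtain ⟨n, hn⟩ := mem_iUnion.1 (hDuniv ▸ mem_univ (X i ω))
    rw [ENNReal.tsum_mul_right, tsum_eq_single n fun m hm => indicator_of_notMem
      (disjoint_right.1 (disjoint_disjointed _ hm) hn) _,
      indicator_of_mem hn, Pi.one_apply, one_mul]
  calc ∫⁻ ω, ∑' i, ∏' j : {j // j ≠ i}, F (ρ (X i ω)) (X j ω) ∂P
    _ = ∫⁻ ω, ∑' n, ∑' i, (D n).indicator 1 (X i ω) *
          ∏' j : {j // j ≠ i}, F (ρ (X i ω)) (X j ω) ∂P :=
      lintegral_congr fun ω => (tsum_congr fun i => hsum i ω _).trans ENNReal.tsum_comm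
    _ = ∑' n, ∫⁻ p in D n, expNeg (∫⁻ q, 1 - F (ρ p) q ∂ν) ∂ν := by
      rw [lintegral_tsum fun n => (Measurable.tsum fun i =>
        hX.measurable_indicator_mul_tprod_ne_uncurry (hD n) hK i).aemeasurable]
      exact tsum_congr fun n =>
        hX.lintegral_tsum_indicator_mul_tprod_ne_comp hρ hF hF1 hanti hcont (hD n) (hνD n)
    _ = ∫⁻ p, expNeg (∫⁻ q, 1 - F (ρ p) q ∂ν) ∂ν := by
      rw [← lintegral_iUnion hD (disjoint_disjointed _), hDuniv, setLIntegral_univ]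

end Mecke

end IsPPP

/-! ### Rayleigh fading -/

section RayleighFading

lemma iIndepFun_indepFun_subtype_ne {Ω ι : Type*} [MeasurableSpace Ω] {P : Measure Ω}
    {𝓧 : ι → Type*} [∀ i, MeasurableSpace (𝓧 i)] {f : ∀ i, Ω → 𝓧 i} (hf : iIndepFun f P)
    (hm : ∀ i, Measurable (f i)) (i : ι) :
    IndepFun (f i) (fun ω (j : {j // j ≠ i}) => f j ω) P := by
  have h := indep_iSup_of_disjoint (fun j => (hm j).comap_le) hf
    (disjoint_compl_right (a := {i}))
  rw [IndepFun_iff_Indep]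
  refine indep_of_indep_of_le_left (indep_of_indep_of_le_right h ?_) ?_
  · rw [MeasurableSpace.pi, MeasurableSpace.comap_iSup]
    refine iSup_le fun j => ?_
    rw [MeasurableSpace.comap_comp]
    exact le_iSup₂_of_le j.1 j.2 le_rfl
  · exact le_iSup₂_of_le i rfl le_rfl

lemma expMeasure_one_setOf_lt_ofReal (y : ℝ≥0∞) :
    expMeasure 1 {z | y < ENNReal.ofReal z} = expNeg y := by
  have := isProbabilityMeasure_expMeasure zero_lt_one
  induction y using ENNReal.recTopCoe with
  | top => simp [expNeg_top]
  | coe y =>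
    have hset : {z : ℝ | (y : ℝ≥0∞) < ENNReal.ofReal z} = (Iic (y : ℝ))ᶜ := by
      ext z
      simp [ENNReal.lt_ofReal_iff_toReal_lt]
    have hcdf : expMeasure 1 (Iic (y : ℝ)) = ENNReal.ofReal (1 - Real.exp (-y)) := by
      rw [← ofReal_cdf, cdf_expMeasure_eq zero_lt_one, if_pos y.coe_nonneg, one_mul]
    rw [hset, prob_compl_eq_one_sub measurableSet_Iic, hcdf, ← ENNReal.ofReal_one,
      ← ENNReal.ofReal_sub _ (by simp), sub_sub_cancel, ← expNeg_ofReal y.coe_nonneg,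
      ENNReal.ofReal_coe_nnreal]

lemma lintegral_expNeg_expMeasure_one {c : ℝ} (hc : 0 ≤ c) :
    ∫⁻ z, expNeg (ENNReal.ofReal (z * c)) ∂(expMeasure 1) = ENNReal.ofReal (1 / (1 + c)) := by
  have hm : Measurable fun z : ℝ => expNeg (ENNReal.ofReal (z * c)) :=
    continuous_expNeg.measurable.comp (measurable_id.mul_const c).ennreal_ofReal
  have hpdf : ∀ r, Measurable (exponentialPDF r) := fun r =>
    (measurable_exponentialPDFReal r).ennreal_ofReal
  have htilt : ∀ z, (exponentialPDF 1 * fun z => expNeg (ENNReal.ofReal (z * c))) z =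
      ENNReal.ofReal (1 / (1 + c)) * exponentialPDF (1 + c) z := fun z => by
    rw [Pi.mul_apply]
    rcases le_or_gt 0 z with hz | hz
    · rw [exponentialPDF_of_nonneg hz, exponentialPDF_of_nonneg hz, expNeg_ofReal (by positivity),
        ← ENNReal.ofReal_mul (by positivity), ← ENNReal.ofReal_mul (by positivity), one_mul,
        ← Real.exp_add, ← mul_assoc, one_div, inv_mul_cancel₀ (by positivity), one_mul]
      ring_nf
    · simp [exponentialPDF_of_neg hz]
  calc ∫⁻ z, expNeg (ENNReal.ofReal (z * c)) ∂(expMeasure 1)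
    _ = ∫⁻ z, (exponentialPDF 1 * fun z => expNeg (ENNReal.ofReal (z * c))) z :=
      lintegral_withDensity_eq_lintegral_mul _ (hpdf 1) hm
    _ = ENNReal.ofReal (1 / (1 + c)) := by
      rw [lintegral_congr htilt, lintegral_const_mul _ (hpdf _),
        lintegral_exponentialPDF_eq_one (by linarith), mul_one]

variable {Ω : Type*} [MeasurableSpace Ω] {P : Measure Ω}

lemma measure_lt_ofReal_of_hasLaw_expMeasure_one [IsFiniteMeasure P] {G : Ω → ℝ} {Y : Ω → ℝ≥0∞}
    (hG : HasLaw G (expMeasure 1) P) (hY : Measurable Y) (hGY : IndepFun G Y P) :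
    P {ω | Y ω < ENNReal.ofReal (G ω)} = ∫⁻ ω, expNeg (Y ω) ∂P := by
  have := isProbabilityMeasure_expMeasure zero_lt_one
  have hS : MeasurableSet {p : ℝ≥0∞ × ℝ | p.1 < ENNReal.ofReal p.2} :=
    measurableSet_lt measurable_fst measurable_snd.ennreal_ofReal
  calc P {ω | Y ω < ENNReal.ofReal (G ω)}
    _ = P.map (fun ω => (Y ω, G ω)) {p | p.1 < ENNReal.ofReal p.2} :=
      (Measure.map_apply_of_aemeasurable (hY.aemeasurable.prodMk hG.aemeasurable) hS).symm
    _ = ∫⁻ y, expMeasure 1 {z | y < ENNReal.ofReal z} ∂(P.map Y) := by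
      rw [(indepFun_iff_map_prod_eq_prod_map_map hY.aemeasurable hG.aemeasurable).1 hGY.symm,
        hG.map_eq, Measure.prod_apply hS]
      rfl
    _ = ∫⁻ ω, expNeg (Y ω) ∂P := by
      simp only [expMeasure_one_setOf_lt_ofReal]
      exact lintegral_map continuous_expNeg.measurable hY

lemma measure_tsum_ne_lt_eq_tprod_ne {ι : Type*} [Countable ι] {g : ι → Ω → ℝ}
    (hm : ∀ i, Measurable (g i)) (hlaw : ∀ i, HasLaw (g i) (expMeasure 1) P)
    (hind : iIndepFun g P) {c : ι → ℝ} (hc : ∀ j, 0 ≤ c j) (i : ι) :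
    P {ω | ∑' j : {j // j ≠ i}, ENNReal.ofReal (g j ω * c j) < ENNReal.ofReal (g i ω)} =
      ∏' j : {j // j ≠ i}, ENNReal.ofReal (1 / (1 + c j)) := by
  have := hind.isProbabilityMeasure
  have hφ : ∀ j, Measurable fun z : ℝ => expNeg (ENNReal.ofReal (z * c j)) := fun j =>
    continuous_expNeg.measurable.comp (measurable_id.mul_const _).ennreal_ofReal
  have hY : Measurable fun ω => ∑' j : {j // j ≠ i}, ENNReal.ofReal (g j ω * c j) :=
    .tsum fun j => ((hm j).mul_const _).ennreal_ofReal
  have hgY : IndepFun (g i) (fun ω => ∑' j : {j // j ≠ i}, ENNReal.ofReal (g j ω * c j)) P :=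
    (iIndepFun_indepFun_subtype_ne hind hm i).comp (φ := id)
      (ψ := fun f : {j // j ≠ i} → ℝ => ∑' j, ENNReal.ofReal (f j * c j)) measurable_id
      (.tsum fun j => ((measurable_pi_apply j).mul_const _).ennreal_ofReal)
  have hind' : iIndepFun (fun (j : {j // j ≠ i}) ω => expNeg (ENNReal.ofReal (g j ω * c j))) P :=
    (hind.comp (fun j z => expNeg (ENNReal.ofReal (z * c j))) hφ).precomp
      Subtype.val_injective
  rw [measure_lt_ofReal_of_hasLaw_expMeasure_one (hlaw i) hY hgY]
  simp only [expNeg_tsum]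
  rw [lintegral_tprod_of_iIndepFun
    (f := fun (j : {j // j ≠ i}) ω => expNeg (ENNReal.ofReal (g j ω * c j)))
    (fun j => (hφ j).comp (hm j)) (fun _ _ => expNeg_le_one _) hind']
  refine tprod_congr fun j => ?_
  rw [(hlaw j).lintegral_comp (hφ j).aemeasurable, lintegral_expNeg_expMeasure_one (hc j)]

end RayleighFading

lemma ofReal_lt_div_tsum_ne_iff {ι : Type*} {a ℓ : ι → ℝ} {i : ι} (hℓ : 0 < ℓ i) {θ : ℝ}
    (hθ : 0 < θ) :
    ENNReal.ofReal θ < ENNReal.ofReal (a i * ℓ i) /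
        ∑' j : {j // j ≠ i}, ENNReal.ofReal (a j * ℓ j) ↔
      ∑' j : {j // j ≠ i}, ENNReal.ofReal (a j * (θ * ℓ j / ℓ i)) < ENNReal.ofReal (a i) := by
  have hscale : ∀ j, ENNReal.ofReal θ * ENNReal.ofReal (a j * ℓ j) * (ENNReal.ofReal (ℓ i))⁻¹ =
      ENNReal.ofReal (a j * (θ * ℓ j / ℓ i)) := fun j => by
    rw [← ENNReal.ofReal_inv_of_pos hℓ, ← ENNReal.ofReal_mul hθ.le,
      ← ENNReal.ofReal_mul' (inv_nonneg.2 hℓ.le)]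
    ring_nf
  rw [ENNReal.lt_div_iff_mul_lt (.inr ENNReal.ofReal_ne_top) (.inr (by simpa using hθ)),
    ENNReal.ofReal_mul' hℓ.le, ← ENNReal.div_lt_iff (.inl (by simpa using hℓ))
    (.inl ENNReal.ofReal_ne_top), ← ENNReal.tsum_mul_left, div_eq_mul_inv,
    ← ENNReal.tsum_mul_right]
  simp only [hscale]

/-! ### The hypergeometric function as an interference integral -/

lemma hasSum_integral_mul_geometric {E : Type*} [MeasurableSpace E] {μ : Measure E} {a q : E → ℝ}
    {ρ : ℝ} (ha : Integrable a μ) (hq : AEStronglyMeasurable q μ) (hρ0 : 0 ≤ ρ) (hρ1 : ρ < 1)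
    (hqρ : ∀ᵐ x ∂μ, |q x| ≤ ρ) :
    HasSum (fun n : ℕ => ∫ x, a x * q x ^ n ∂μ) (∫ x, a x / (1 - q x) ∂μ) := by
  have hgeom : ∀ x, HasSum (fun n : ℕ => |a x| * ρ ^ n) (|a x| * (1 - ρ)⁻¹) := fun x =>
    (hasSum_geometric_of_lt_one hρ0 hρ1).mul_left _
  refine hasSum_integral_of_dominated_convergence (fun n x => |a x| * ρ ^ n)
    (fun n => ha.aestronglyMeasurable.mul (hq.pow n)) (fun n => ?_)
    (ae_of_all _ fun x => (hgeom x).summable) ?_ ?_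
  · filter_upwards [hqρ] with x hx
    rw [Real.norm_eq_abs, abs_mul, abs_pow]
    gcongr
  · simpa only [(hgeom _).tsum_eq] using ha.abs.mul_const _
  · filter_upwards [hqρ] with x hx
    exact (hasSum_geometric_of_abs_lt_one (hx.trans_lt hρ1)).mul_left (a x)

lemma rpow_neg_mem_Ioo {β u : ℝ} (hβ : 0 < β) (hu : 1 < u) : u ^ (-β) ∈ Ioo (0 : ℝ) 1 :=
  ⟨Real.rpow_pos_of_pos (by linarith) _, Real.rpow_lt_one_of_one_lt_of_neg hu (by linarith)⟩

section

variable {β : ℝ}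

lemma integrableOn_Ioi_rpow_neg (hβ : 1 < β) :
    IntegrableOn (fun u : ℝ => u ^ (-β)) (Ioi 1) :=
  integrableOn_Ioi_rpow_of_lt (by linarith) zero_lt_one

lemma integral_Ioi_rpow_neg_pow (hβ : 1 < β) (n : ℕ) :
    ∫ u in Ioi (1 : ℝ), (u ^ (-β)) ^ (n + 1) = 1 / (β * (n + 1) - 1) := by
  have hexp : -β * ((n + 1 : ℕ) : ℝ) < -1 := by
    have : (0 : ℝ) ≤ n := n.cast_nonneg
    push_cast
    nlinarith
  rw [setIntegral_congr_fun (g := fun u : ℝ => u ^ (-β * ((n + 1 : ℕ) : ℝ))) measurableSet_Ioi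
    fun u hu => (Real.rpow_mul_natCast (zero_le_one.trans (le_of_lt hu)) _ _).symm,
    integral_Ioi_rpow_of_lt hexp zero_lt_one, Real.one_rpow, neg_div, ← div_neg]
  push_cast
  ring

lemma integrableOn_Ioi_rpow_neg_mul_one_sub_pow (hβ : 1 < β) (n : ℕ) :
    IntegrableOn (fun u : ℝ => u ^ (-β) * (1 - u ^ (-β)) ^ n) (Ioi 1) := by
  refine (integrableOn_Ioi_rpow_neg hβ).mul_of_top_left ?_
  refine memLp_top_of_bound (by fun_prop) 1 ?_
  filter_upwards [ae_restrict_mem measurableSet_Ioi] with u hu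
  obtain ⟨hv0, hv1⟩ := rpow_neg_mem_Ioo (β := β) (by linarith) hu
  rw [norm_pow, Real.norm_of_nonneg (by linarith)]
  exact pow_le_one₀ (by linarith) (by linarith)

lemma tendsto_mul_rpow_neg_mul_one_sub_pow (hβ : 1 < β) (n : ℕ) :
    Tendsto (fun u : ℝ => u * (u ^ (-β) * (1 - u ^ (-β)) ^ n)) atTop (𝓝 0) := by
  refine squeeze_zero' ?_ ?_ (tendsto_rpow_neg_atTop (y := β - 1) (by linarith)) <;>
    filter_upwards [eventually_gt_atTop 1] with u hu <;>
    obtain ⟨hv0, hv1⟩ := rpow_neg_mem_Ioo (β := β) (by linarith) hu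
  · exact mul_nonneg (by linarith) (mul_nonneg hv0.le (pow_nonneg (by linarith) _))
  · rw [show -(β - 1) = -β + 1 by ring, Real.rpow_add_one (by linarith), mul_comm u]
    exact mul_le_mul_of_nonneg_right
      (mul_le_of_le_one_right hv0.le (pow_le_one₀ (by linarith) (by linarith))) (by linarith)

lemma integral_Ioi_rpow_neg_mul_one_sub_pow_succ (hβ : 1 < β) (n : ℕ) :
    (β * (n + 2) - 1) * ∫ u in Ioi (1 : ℝ), u ^ (-β) * (1 - u ^ (-β)) ^ (n + 1) =
      (n + 1) * β * ∫ u in Ioi (1 : ℝ), u ^ (-β) * (1 - u ^ (-β)) ^ n := by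
  have hderiv : ∀ u ∈ Ici (1 : ℝ), HasDerivAt
      (fun u : ℝ => u * (u ^ (-β) * (1 - u ^ (-β)) ^ (n + 1)))
      ((n + 1) * β * (u ^ (-β) * (1 - u ^ (-β)) ^ n) -
        (β * (n + 2) - 1) * (u ^ (-β) * (1 - u ^ (-β)) ^ (n + 1))) u := by
    intro u hu
    have hu0 : u ≠ 0 := (zero_lt_one.trans_le hu).ne'
    have hv : HasDerivAt (fun u : ℝ => u ^ (-β)) (-β * u ^ (-β) / u) u := by
      simpa only [Real.rpow_sub_one hu0, mul_div_assoc] using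
        Real.hasDerivAt_rpow_const (p := -β) (Or.inl hu0)
    refine ((hasDerivAt_id' u).mul (hv.mul ((hv.const_sub 1).pow (n + 1)))).congr_deriv ?_
    simp only [Pi.mul_apply, Pi.pow_apply, Nat.add_sub_cancel, Nat.cast_add, Nat.cast_one]
    field_simp
    ring
  have hint := fun k => integrableOn_Ioi_rpow_neg_mul_one_sub_pow hβ k
  have hzero := integral_Ioi_of_hasDerivAt_of_tendsto' hderiv
    (((hint n).const_mul _).sub ((hint (n + 1)).const_mul _))
    (tendsto_mul_rpow_neg_mul_one_sub_pow hβ (n + 1))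
  rw [integral_sub ((hint n).const_mul _) ((hint (n + 1)).const_mul _), integral_const_mul,
    integral_const_mul] at hzero
  simp only [Real.one_rpow, sub_self, ne_eq, Nat.add_eq_zero_iff, one_ne_zero, and_false,
    not_false_eq_true, zero_pow, mul_zero] at hzero
  linarith

lemma integral_Ioi_rpow_neg_mul_one_sub_pow (hβ : 1 < β) (n : ℕ) :
    ∫ u in Ioi (1 : ℝ), u ^ (-β) * (1 - u ^ (-β)) ^ n =
      n.factorial / (β * (ascPochhammer ℝ (n + 1)).eval (1 - 1 / β)) := by
  have hδ : 0 < 1 - 1 / β := sub_pos.2 ((div_lt_one (by linarith)).2 hβ)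
  induction n with
  | zero =>
    have h := integral_Ioi_rpow_neg_pow hβ 0
    simp only [zero_add, pow_one, pow_zero, mul_one, Nat.cast_zero] at h ⊢
    rw [h, ascPochhammer_one, Polynomial.eval_X, Nat.factorial_zero, mul_one_sub,
      mul_one_div_cancel (by linarith), Nat.cast_one]
  | succ n ih =>
    have hrec := integral_Ioi_rpow_neg_mul_one_sub_pow_succ hβ n
    have hn : 0 < β * (n + 2) - 1 := by
      have : (0 : ℝ) ≤ n := n.cast_nonneg
      nlinarith
    have hc : 1 - 1 / β + (n + 1 : ℕ) = (β * (n + 2) - 1) / β := by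
      push_cast
      field_simp
      ring
    have hp := ascPochhammer_pos (n + 1) _ hδ
    rw [ih] at hrec
    rw [eq_div_of_mul_eq hn.ne' ((mul_comm _ _).trans hrec), ascPochhammer_succ_eval (n + 1), hc,
      Nat.factorial_succ]
    push_cast
    field_simp

end

lemma hasSum_sub_mul_pow_succ {a : ℕ → ℝ} {w S : ℝ} (h : HasSum (fun n => a n * w ^ n) S) :
    HasSum (fun n => (a (n + 1) - a n) * w ^ (n + 1)) ((1 - w) * S - a 0) := by
  have hshift := (hasSum_nat_add_iff' 1).2 h
  convert! hshift.sub (h.mul_left w) using 1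
  · ext n
    ring
  · simp only [Finset.range_one, Finset.sum_singleton, pow_zero, mul_one]
    ring

lemma hasSum_ordinaryHypergeometric_one {b c x : ℝ} (hb : ∀ n : ℕ, (n : ℝ) ≠ -b)
    (hc : ∀ n : ℕ, (n : ℝ) ≠ -c) (hx : |x| < 1) :
    HasSum (fun n : ℕ => (ascPochhammer ℝ n).eval b / (ascPochhammer ℝ n).eval c * x ^ n)
      (ordinaryHypergeometric 1 b c x) := by
  have hone : ∀ n : ℕ, (n : ℝ) ≠ -1 := fun n => by
    have : (0 : ℝ) ≤ n := n.cast_nonneg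
    linarith
  have hx' : x ∈ Metric.eball 0 (ordinaryHypergeometricSeries ℝ 1 b c).radius := by
    rw [ordinaryHypergeometricSeries_radius_eq_one ℝ 1 b c fun n => ⟨hone n, hb n, hc n⟩,
      Metric.mem_eball, edist_zero_right, ← ofReal_norm, Real.norm_eq_abs]
    exact ENNReal.ofReal_lt_one.2 hx
  have hsum := (ordinaryHypergeometricSeries ℝ 1 b c).hasSum hx'
  simp only [ordinaryHypergeometricSeries_apply_eq, ascPochhammer_eval_one, smul_eq_mul] at hsum
  refine hsum.congr_fun fun n => ?_
  rw [inv_mul_cancel₀ (Nat.cast_ne_zero.2 n.factorial_ne_zero), one_mul, div_eq_mul_inv]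

lemma ascPochhammer_succ_eval_neg_div {δ : ℝ} (hδ : δ < 1) (n : ℕ) :
    (ascPochhammer ℝ (n + 1)).eval (-δ) / (ascPochhammer ℝ (n + 1)).eval (1 - δ) =
      -(δ / (n + 1 - δ)) := by
  have h := ascPochhammer_succ_eval (n + 1) (-δ)
  rw [ascPochhammer_succ_left, Polynomial.eval_mul, Polynomial.eval_X, Polynomial.eval_comp,
    Polynomial.eval_add, Polynomial.eval_X, Polynomial.eval_one, neg_add_eq_sub] at h
  have hpos := ascPochhammer_pos (n + 1) (1 - δ) (sub_pos.2 hδ)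
  have hn : 0 < n + 1 - δ := by
    have : (0 : ℝ) ≤ n := n.cast_nonneg
    linarith
  rw [← neg_div, div_eq_div_iff hpos.ne' hn.ne', h]
  push_cast
  ring

lemma ascPochhammer_eval_one_div_sub {c : ℝ} (hc : 0 < c) (n : ℕ) :
    (ascPochhammer ℝ (n + 1)).eval 1 / (ascPochhammer ℝ (n + 1)).eval c -
        (ascPochhammer ℝ n).eval 1 / (ascPochhammer ℝ n).eval c =
      (1 - c) * n.factorial / (ascPochhammer ℝ (n + 1)).eval c := by
  have hp := ascPochhammer_pos n c hc
  have : 0 < c + n := by positivity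
  rw [ascPochhammer_eval_one, ascPochhammer_eval_one, ascPochhammer_succ_eval, Nat.factorial_succ]
  push_cast
  field_simp
  ring

section

variable {β s : ℝ}

lemma hasSum_integral_Ioi_div_add_rpow (hβ : 1 < β) (hs : 0 ≤ s) (hs1 : s < 1) :
    HasSum (fun n : ℕ => -(-s) ^ (n + 1) / (β * (n + 1) - 1))
      (∫ u in Ioi (1 : ℝ), s / (s + u ^ β)) := by
  have hgeom := hasSum_integral_mul_geometric (q := fun u => -s * u ^ (-β))
    ((integrableOn_Ioi_rpow_neg hβ).const_mul s) (by fun_prop) hs hs1 <| by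
      filter_upwards [ae_restrict_mem measurableSet_Ioi] with u hu
      obtain ⟨hv0, hv1⟩ := rpow_neg_mem_Ioo (β := β) (by linarith) hu
      rw [neg_mul, abs_neg, abs_of_nonneg (by positivity)]
      exact mul_le_of_le_one_right hs hv1.le
  convert! hgeom using 1
  · ext n
    have hpow : ∀ u : ℝ, s * u ^ (-β) * (-s * u ^ (-β)) ^ n =
        -(-s) ^ (n + 1) * (u ^ (-β)) ^ (n + 1) := fun u => by ring
    simp_rw [hpow, integral_const_mul, integral_Ioi_rpow_neg_pow hβ, mul_one_div]
  · refine setIntegral_congr_fun measurableSet_Ioi fun u hu => ?_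
    have hu0 : 0 < u ^ β := Real.rpow_pos_of_pos (zero_lt_one.trans hu) β
    simp only [Real.rpow_neg (zero_lt_one.trans hu).le, neg_mul, sub_neg_eq_add]
    field_simp
    rw [add_comm]

/-- The geometric expansion of the integrand after the substitution `w = s / (1 + s)` of the Pfaff
transformation, which makes it converge for every `s`. -/
lemma hasSum_integral_Ioi_div_add_rpow_pfaff (hβ : 1 < β) (hs : 0 ≤ s) :
    HasSum (fun n : ℕ => n.factorial / (β * (ascPochhammer ℝ (n + 1)).eval (1 - 1 / β)) *
        (s / (1 + s)) ^ (n + 1))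
      (∫ u in Ioi (1 : ℝ), s / (s + u ^ β)) := by
  set w := s / (1 + s) with hw
  have hw0 : 0 ≤ w := by positivity
  have hw1 : w < 1 := (div_lt_one (by positivity)).2 (by linarith)
  have hgeom := hasSum_integral_mul_geometric (q := fun u => w * (1 - u ^ (-β)))
    ((integrableOn_Ioi_rpow_neg hβ).const_mul w) (by fun_prop) hw0 hw1 <| by
      filter_upwards [ae_restrict_mem measurableSet_Ioi] with u hu
      obtain ⟨hv0, hv1⟩ := rpow_neg_mem_Ioo (β := β) (by linarith) hu
      rw [abs_of_nonneg (mul_nonneg hw0 (by linarith))]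
      exact mul_le_of_le_one_right hw0 (by linarith)
  convert! hgeom using 1
  · ext n
    have hpow : ∀ u : ℝ, w * u ^ (-β) * (w * (1 - u ^ (-β))) ^ n =
        u ^ (-β) * (1 - u ^ (-β)) ^ n * w ^ (n + 1) := fun u => by rw [mul_pow]; ring
    simp_rw [hpow, integral_mul_const, integral_Ioi_rpow_neg_mul_one_sub_pow hβ]
  · refine setIntegral_congr_fun measurableSet_Ioi fun u hu => ?_
    have hu0 : 0 < u ^ β := Real.rpow_pos_of_pos (zero_lt_one.trans hu) β
    have hden : 1 - w * (1 - (u ^ β)⁻¹) = (s + u ^ β) / ((1 + s) * u ^ β) := by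
      rw [hw]
      field_simp
      ring
    simp only [Real.rpow_neg (zero_lt_one.trans hu).le, hden]
    rw [hw]
    field_simp

lemma ordinaryHypergeometric_eq_one_add_integral (hβ : 1 < β) (hs : 0 ≤ s) (hs1 : s < 1) :
    ordinaryHypergeometric 1 (-(1 / β)) (1 - 1 / β) (-s) =
      1 + ∫ u in Ioi (1 : ℝ), s / (s + u ^ β) := by
  have hβ0 : 0 < β := by linarith
  have hδ0 : 0 < 1 / β := by positivity
  have hδ1 : 1 / β < 1 := (div_lt_one hβ0).2 hβ
  have hb : ∀ n : ℕ, (n : ℝ) ≠ - -(1 / β) := fun n hn => by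
    have h0 : (0 : ℝ) < n := by linarith
    have h1 : (n : ℝ) < 1 := by linarith
    norm_cast at h0 h1
    omega
  have hc : ∀ n : ℕ, (n : ℝ) ≠ -(1 - 1 / β) := fun n => by
    have : (0 : ℝ) ≤ n := n.cast_nonneg
    linarith
  have hseries := (hasSum_nat_add_iff' 1).2
    (hasSum_ordinaryHypergeometric_one hb hc (x := -s) (by rwa [abs_neg, abs_of_nonneg hs]))
  have hcoeff : ∀ n : ℕ, (ascPochhammer ℝ (n + 1)).eval (-(1 / β)) /
      (ascPochhammer ℝ (n + 1)).eval (1 - 1 / β) * (-s) ^ (n + 1) =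
        -(-s) ^ (n + 1) / (β * (n + 1) - 1) := fun n => by
    rw [ascPochhammer_succ_eval_neg_div hδ1,
      show (n : ℝ) + 1 - 1 / β = (β * (n + 1) - 1) / β by field_simp]
    field_simp
  simp only [hcoeff] at hseries
  have heq := hseries.unique (hasSum_integral_Ioi_div_add_rpow hβ hs hs1)
  simpa only [Finset.range_one, Finset.sum_singleton, ascPochhammer_zero, Polynomial.eval_one,
    div_one, pow_zero, mul_one, sub_eq_iff_eq_add'] using heq

lemma ordinaryHypergeometric_pfaff_eq_one_add_integral (hβ : 1 < β) (hs : 0 ≤ s) :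
    (1 + s)⁻¹ * ordinaryHypergeometric 1 1 (1 - 1 / β) (s / (1 + s)) =
      1 + ∫ u in Ioi (1 : ℝ), s / (s + u ^ β) := by
  have hδ : 0 < 1 - 1 / β := sub_pos.2 ((div_lt_one (by linarith)).2 hβ)
  have hne : ∀ c : ℝ, 0 < c → ∀ n : ℕ, (n : ℝ) ≠ -c := fun c hc n => by
    have : (0 : ℝ) ≤ n := n.cast_nonneg
    linarith
  have hw1 : |s / (1 + s)| < 1 := by
    rw [abs_of_nonneg (by positivity), div_lt_one (by positivity)]
    linarith
  have hseries := hasSum_sub_mul_pow_succ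
    (hasSum_ordinaryHypergeometric_one (hne 1 one_pos) (hne _ hδ) hw1)
  have hcoeff : ∀ n : ℕ, (ascPochhammer ℝ (n + 1)).eval 1 /
      (ascPochhammer ℝ (n + 1)).eval (1 - 1 / β) -
        (ascPochhammer ℝ n).eval 1 / (ascPochhammer ℝ n).eval (1 - 1 / β) =
      n.factorial / (β * (ascPochhammer ℝ (n + 1)).eval (1 - 1 / β)) := fun n => by
    rw [ascPochhammer_eval_one_div_sub hδ, sub_sub_cancel, one_div_mul_eq_div, div_div]
  simp only [hcoeff] at hseries
  have heq := hseries.unique (hasSum_integral_Ioi_div_add_rpow_pfaff hβ hs)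
  simp only [ascPochhammer_zero, Polynomial.eval_one, div_one, sub_eq_iff_eq_add'] at heq
  rw [← heq]
  congr 1
  field_simp
  ring

lemma gaussHypergeometric_eq_one_add_integral (hβ : 1 < β) (hs : 0 ≤ s) :
    gaussHypergeometric 1 (-(1 / β)) (1 - 1 / β) (-s) =
      1 + ∫ u in Ioi (1 : ℝ), s / (s + u ^ β) := by
  rw [gaussHypergeometric, abs_neg, abs_of_nonneg hs]
  split_ifs with hs1
  · exact ordinaryHypergeometric_eq_one_add_integral hβ hs hs1
  · rw [← ordinaryHypergeometric_pfaff_eq_one_add_integral hβ hs, Real.rpow_neg_one,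
      sub_neg_eq_add, sub_neg_eq_add, sub_add_cancel, neg_sub_left, neg_div_neg_eq]

end

section

variable {α s : ℝ}

lemma eta_one_eq_eta_one_one (α s r : ℝ) : eta α s 1 r = eta α (s / r ^ α) 1 1 := by
  simp only [eta, one_mul, Real.one_rpow, div_one]

lemma eta_one_one_eq_one_add_integral (hα : 2 < α) (hs : 0 ≤ s) :
    eta α s 1 1 = 1 + ∫ u in Ioi (1 : ℝ), s / (s + u ^ (α / 2)) := by
  rw [← gaussHypergeometric_eq_one_add_integral (by linarith) hs, one_div_div, eta,
    Real.one_rpow, one_mul, div_one]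

lemma eta_zero (hα : 2 < α) : eta α 0 1 1 = 1 := by
  simp [eta_one_one_eq_one_add_integral hα le_rfl]

lemma one_le_eta (hα : 2 < α) (hs : 0 ≤ s) : 1 ≤ eta α s 1 1 := by
  rw [eta_one_one_eq_one_add_integral hα hs, le_add_iff_nonneg_right]
  refine setIntegral_nonneg measurableSet_Ioi fun u hu => ?_
  have := Real.rpow_pos_of_pos (zero_lt_one.trans hu) (α / 2)
  positivity

lemma integrableOn_Ioi_div_add_rpow {β : ℝ} (hβ : 1 < β) (hs : 0 ≤ s) :
    IntegrableOn (fun u : ℝ => s / (s + u ^ β)) (Ioi 1) := by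
  refine ((integrableOn_Ioi_rpow_neg hβ).const_mul s).mono'
    (Measurable.aestronglyMeasurable (by fun_prop)) ?_
  filter_upwards [ae_restrict_mem measurableSet_Ioi] with u hu
  have hu0 : 0 < u ^ β := Real.rpow_pos_of_pos (zero_lt_one.trans hu) β
  rw [Real.norm_of_nonneg (by positivity), Real.rpow_neg (zero_lt_one.trans hu).le,
    ← div_eq_mul_inv]
  gcongr
  linarith

lemma lintegral_Ioi_div_add_rpow (hα : 2 < α) (hs : 0 ≤ s) :
    ∫⁻ u in Ioi (1 : ℝ), ENNReal.ofReal (s / (s + u ^ (α / 2))) =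
      ENNReal.ofReal (eta α s 1 1 - 1) := by
  rw [eta_one_one_eq_one_add_integral hα hs, add_sub_cancel_left,
    ofReal_integral_eq_lintegral_ofReal (integrableOn_Ioi_div_add_rpow (by linarith) hs)]
  filter_upwards [ae_restrict_mem measurableSet_Ioi] with u hu
  have := Real.rpow_pos_of_pos (zero_lt_one.trans hu) (α / 2)
  simp only [Pi.zero_apply]
  positivity

lemma stronglyMeasurable_integral_Ioi_div_add_rpow (β : ℝ) :
    StronglyMeasurable fun s : ℝ => ∫ u in Ioi (1 : ℝ), s / (s + u ^ β) :=
  StronglyMeasurable.integral_prod_right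
    (f := fun s u : ℝ => s / (s + u ^ β))
    (Measurable.stronglyMeasurable (by unfold Function.uncurry; fun_prop))

lemma mul_sub_one_le_eta_sub_one (hα : 2 < α) {θ M : ℝ} (hθ : 0 ≤ θ) (hM : 1 ≤ M) :
    θ / (1 + θ) * (M - 1) ≤ eta α (θ * M ^ (α / 2)) 1 1 - 1 := by
  have : 0 < M := by linarith
  have hs : 0 ≤ θ * M ^ (α / 2) := by positivity
  have hint := integrableOn_Ioi_div_add_rpow (β := α / 2) (by linarith) hs
  rw [eta_one_one_eq_one_add_integral hα hs, add_sub_cancel_left]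
  calc θ / (1 + θ) * (M - 1)
      = ∫ _ in Ioc 1 M, θ / (1 + θ) := by
        rw [setIntegral_const, Real.volume_real_Ioc_of_le hM, smul_eq_mul, mul_comm]
    _ ≤ ∫ u in Ioc 1 M, θ * M ^ (α / 2) / (θ * M ^ (α / 2) + u ^ (α / 2)) := by
        refine setIntegral_mono_on (by simp) (hint.mono_set Ioc_subset_Ioi_self) measurableSet_Ioc
          fun u ⟨hu1, huM⟩ => ?_
        have huM' : u ^ (α / 2) ≤ M ^ (α / 2) := by gcongr
        have : 0 < M ^ (α / 2) := by positivity
        rw [div_le_div_iff₀ (by positivity) (by positivity)]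
        nlinarith [mul_le_mul_of_nonneg_left huM' hθ]
    _ ≤ _ := by
        refine setIntegral_mono_set hint ?_ Ioc_subset_Ioi_self.eventuallyLE
        filter_upwards [ae_restrict_mem measurableSet_Ioi] with u hu
        have := Real.rpow_pos_of_pos (zero_lt_one.trans hu) (α / 2)
        simp only [Pi.zero_apply]
        positivity

end

/-! ### Radial integrals in the plane -/

lemma volume_plane_norm_sq_mem_Ico {a b : ℝ} (hab : a ≤ b) :
    volume {q : Plane | ‖q‖ ^ 2 ∈ Ico a b} = ENNReal.ofReal (Real.pi * (max b 0 - max a 0)) := by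
  have hdiff : {q : Plane | ‖q‖ ^ 2 ∈ Ico a b} = Metric.ball 0 √b \ Metric.ball 0 √a := by
    ext q
    simp only [mem_ofPred_eq, mem_Ico, Set.mem_sdiff, mem_ball_zero_iff, not_lt, Real.lt_sqrt,
      norm_nonneg, and_comm]
  rw [hdiff, measure_sdiff (Metric.ball_subset_ball (Real.sqrt_le_sqrt hab))
    measurableSet_ball.nullMeasurableSet (by finiteness), EuclideanSpace.volume_ball_fin_two,
    EuclideanSpace.volume_ball_fin_two, ← ENNReal.ofReal_pow (by positivity),
    ← ENNReal.ofReal_pow (by positivity), Real.sq_sqrt', Real.sq_sqrt',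
    ← ENNReal.ofReal_mul (by positivity), ← ENNReal.ofReal_mul (by positivity),
    ← ENNReal.ofReal_sub _ (by positivity)]
  congr 1
  ring

lemma map_norm_sq_volume_plane :
    (volume : Measure Plane).map (fun q => ‖q‖ ^ 2) =
      ENNReal.ofReal Real.pi • volume.restrict (Ici 0) := by
  have hmap {a b : ℝ} (hab : a < b) :
      (volume : Measure Plane).map (fun q => ‖q‖ ^ 2) (Ico a b) =
        ENNReal.ofReal (Real.pi * (max b 0 - max a 0)) := by
    rw [Measure.map_apply (by fun_prop) measurableSet_Ico]
    exact volume_plane_norm_sq_mem_Ico hab.le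
  refine Measure.ext_of_Ico' _ _ (fun a b hab => by simp [hmap hab]) fun a b hab => ?_
  rw [hmap hab, Measure.smul_apply, Measure.restrict_apply measurableSet_Ico, smul_eq_mul,
    ENNReal.ofReal_mul Real.pi_pos.le]
  rw [Ico_inter_Ici, Real.volume_Ico]
  rcases le_total b 0 with hb | hb
  · have ha : a ≤ 0 := by linarith
    simp [ha, hb]
  · rw [max_eq_left hb]

lemma lintegral_plane_norm_sq {f : ℝ → ℝ≥0∞} (hf : Measurable f) {a : ℝ} (ha : 0 ≤ a) :
    ∫⁻ q in {q : Plane | a ≤ ‖q‖}, f (‖q‖ ^ 2) =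
      ENNReal.ofReal Real.pi * ∫⁻ t in Ioi (a ^ 2), f t := by
  have hset : {q : Plane | a ≤ ‖q‖} = (fun q : Plane => ‖q‖ ^ 2) ⁻¹' Ici (a ^ 2) := by
    ext q
    simp [sq_le_sq₀ ha (norm_nonneg q)]
  rw [hset, ← setLIntegral_map measurableSet_Ici hf (by fun_prop), map_norm_sq_volume_plane,
    Measure.restrict_smul, lintegral_smul_measure, Measure.restrict_restrict measurableSet_Ici,
    Ici_inter_Ici, sup_eq_left.2 (sq_nonneg a), restrict_Ioi_eq_restrict_Ici, smul_eq_mul]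

lemma lintegral_Ioi_comp_add_div (f : ℝ → ℝ≥0∞) {a c : ℝ} (hac : 0 < a + c) :
    ∫⁻ t in Ioi a, f ((t + c) / (a + c)) = ENNReal.ofReal (a + c) * ∫⁻ u in Ioi 1, f u := by
  have himg : (fun t : ℝ => (t + c) / (a + c)) '' Ioi a = Ioi 1 := by
    ext u
    constructor
    · rintro ⟨t, ht, rfl⟩
      exact (one_lt_div hac).2 (by linarith [mem_Ioi.1 ht])
    · intro hu
      exact ⟨(a + c) * u - c, by simp only [mem_Ioi] at *; nlinarith, by field_simp; ring⟩
  rw [← himg, lintegral_image_eq_lintegral_deriv_mul_of_monotoneOn measurableSet_Ioi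
    (f' := fun _ => 1 / (a + c))
    (fun t _ => (((hasDerivAt_id' t).add_const c).div_const (a + c)).hasDerivWithinAt)
    (fun t _ s _ hts => by gcongr),
    lintegral_const_mul' _ _ ENNReal.ofReal_ne_top, ← mul_assoc, ← ENNReal.ofReal_mul hac.le,
    mul_one_div_cancel hac.ne', ENNReal.ofReal_one, one_mul]

lemma lintegral_plane_norm_sq_add_div {f : ℝ → ℝ≥0∞} (hf : Measurable f) {a h : ℝ} (ha : 0 ≤ a)
    (hah : 0 < a ^ 2 + h ^ 2) :
    ∫⁻ q in {q : Plane | a ≤ ‖q‖}, f ((‖q‖ ^ 2 + h ^ 2) / (a ^ 2 + h ^ 2)) =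
      ENNReal.ofReal (Real.pi * (a ^ 2 + h ^ 2)) * ∫⁻ u in Ioi 1, f u := by
  rw [lintegral_plane_norm_sq (f := fun t => f ((t + h ^ 2) / (a ^ 2 + h ^ 2))) (by fun_prop) ha,
    lintegral_Ioi_comp_add_div f hah, ← mul_assoc, ← ENNReal.ofReal_mul Real.pi_pos.le]

noncomputable section

variable {α h θ r s : ℝ}

/-- The probability that an exponential fading gain of a station at distance `s` exceeds `θ` times
the relative power received from a single interferer at distance `r`; equivalently, the Laplace
transform of the latter power at `θ / pathloss α h s`. -/
def laplaceFactor (α h θ s r : ℝ) : ℝ≥0∞ :=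
  ENNReal.ofReal (1 / (1 + θ * pathloss α h r / pathloss α h s))

lemma pathloss_nonneg : 0 ≤ pathloss α h r := by
  unfold pathloss
  positivity

lemma pathloss_pos (hr : 0 < r ^ 2 + h ^ 2) : 0 < pathloss α h r :=
  Real.rpow_pos_of_pos hr _

lemma inv_pathloss : (pathloss α h s)⁻¹ = (s ^ 2 + h ^ 2) ^ (α / 2) := by
  rw [pathloss, Real.rpow_neg (by positivity), inv_inv]

lemma laplaceFactor_le_one (hθ : 0 ≤ θ) : laplaceFactor α h θ s r ≤ 1 := by
  have hr := pathloss_nonneg (α := α) (h := h) (r := r)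
  have hs := pathloss_nonneg (α := α) (h := h) (r := s)
  refine ENNReal.ofReal_le_one.2 (div_le_one_of_le₀ ?_ (by positivity))
  linarith [show 0 ≤ θ * pathloss α h r / pathloss α h s by positivity]

lemma laplaceFactor_anti (hα : 0 ≤ α) (hθ : 0 ≤ θ) {s' : ℝ} (hs : 0 ≤ s) (hss' : s ≤ s') :
    laplaceFactor α h θ s' r ≤ laplaceFactor α h θ s r := by
  have hr := pathloss_nonneg (α := α) (h := h) (r := r)
  simp only [laplaceFactor, div_eq_mul_inv _ (pathloss α h _), inv_pathloss]
  gcongr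

lemma continuous_laplaceFactor (hα : 0 ≤ α) (hθ : 0 ≤ θ) :
    Continuous fun s => laplaceFactor α h θ s r := by
  have hr := pathloss_nonneg (α := α) (h := h) (r := r)
  simp only [laplaceFactor, div_eq_mul_inv _ (pathloss α h _), inv_pathloss]
  refine ENNReal.continuous_ofReal.comp (continuous_const.div (continuous_const.add
    (continuous_const.mul (Continuous.rpow_const (by fun_prop) fun _ => Or.inr (by positivity))))
    fun s => ?_)
  positivity

lemma measurable_laplaceFactor {T : Type*} [MeasurableSpace T] {u v : T → ℝ} (hu : Measurable u)
    (hv : Measurable v) : Measurable fun t => laplaceFactor α h θ (u t) (v t) := by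
  unfold laplaceFactor pathloss
  fun_prop

lemma one_sub_laplaceFactor (hθ : 0 ≤ θ) (hr : 0 < r ^ 2 + h ^ 2) {b : ℝ} (hb : 0 < b) :
    1 - laplaceFactor α h θ s r =
      ENNReal.ofReal (θ * ((s ^ 2 + h ^ 2) / b) ^ (α / 2) /
        (θ * ((s ^ 2 + h ^ 2) / b) ^ (α / 2) + ((r ^ 2 + h ^ 2) / b) ^ (α / 2))) := by
  have hs : 0 ≤ s ^ 2 + h ^ 2 := by positivity
  rw [laplaceFactor, div_eq_mul_inv _ (pathloss α h s), inv_pathloss, pathloss,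
    Real.rpow_neg hr.le, Real.div_rpow hs hb.le, Real.div_rpow hr.le hb.le, ← ENNReal.ofReal_one,
    ← ENNReal.ofReal_sub _ (by positivity)]
  have := Real.rpow_nonneg hs (α / 2)
  have := Real.rpow_pos_of_pos hr (α / 2)
  have := Real.rpow_pos_of_pos hb (α / 2)
  congr 1
  field_simp
  ring

lemma lintegral_one_sub_laplaceFactor (hα : 2 < α) (hθ : 0 ≤ θ) {a : ℝ} (ha : 0 ≤ a)
    (hah : 0 < a ^ 2 + h ^ 2) :
    ∫⁻ q in {q : Plane | a ≤ ‖q‖}, (1 - laplaceFactor α h θ s ‖q‖) =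
      ENNReal.ofReal (Real.pi * (a ^ 2 + h ^ 2) *
        (eta α (θ * ((s ^ 2 + h ^ 2) / (a ^ 2 + h ^ 2)) ^ (α / 2)) 1 1 - 1)) := by
  rw [ENNReal.ofReal_mul (by positivity),
    ← lintegral_Ioi_div_add_rpow hα (by positivity),
    ← lintegral_plane_norm_sq_add_div (by fun_prop) ha hah]
  refine setLIntegral_congr_fun (measurableSet_le (by fun_prop) (by fun_prop)) fun q hq => ?_
  have hq : a ^ 2 ≤ ‖q‖ ^ 2 := pow_le_pow_left₀ ha hq 2
  exact one_sub_laplaceFactor hθ (by linarith) hah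

/-- The `laplaceFactor` of an interferer at distance `r`, restricted to the event that it is not
closer to the origin than the serving station at distance `s`. -/
def closestFactor (α h θ s r : ℝ) : ℝ≥0∞ :=
  if s ≤ r then laplaceFactor α h θ s r else 0

lemma closestFactor_le_one (hθ : 0 ≤ θ) : closestFactor α h θ s r ≤ 1 := by
  unfold closestFactor
  split_ifs
  exacts [laplaceFactor_le_one hθ, zero_le_one]

lemma closestFactor_anti (hα : 0 ≤ α) (hθ : 0 ≤ θ) {s' : ℝ} (hs : 0 ≤ s) (hss' : s ≤ s') :
    closestFactor α h θ s' r ≤ closestFactor α h θ s r := by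
  unfold closestFactor
  split_ifs with hs'r hsr
  exacts [laplaceFactor_anti hα hθ hs hss', absurd (hss'.trans hs'r) hsr, zero_le, le_rfl]

lemma continuousWithinAt_closestFactor (hα : 0 ≤ α) (hθ : 0 ≤ θ) :
    ContinuousWithinAt (fun s => closestFactor α h θ s r) (Iic s) s := by
  by_cases hsr : s ≤ r
  · refine (continuous_laplaceFactor (h := h) (r := r) hα hθ).continuousWithinAt.congr
      (fun t ht => if_pos (ht.trans hsr)) (if_pos hsr)
  · refine (continuousAt_const (y := (0 : ℝ≥0∞))).continuousWithinAt.congr_of_eventuallyEq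
      ?_ (if_neg hsr)
    filter_upwards [mem_nhdsWithin_of_mem_nhds (Ioi_mem_nhds (not_le.1 hsr))] with t ht
    exact if_neg (not_le.2 ht)

lemma measurable_closestFactor : Measurable (closestFactor α h θ s) :=
  .ite measurableSet_Ici (measurable_laplaceFactor measurable_const measurable_id) measurable_const

lemma lintegral_one_sub_closestFactor (hα : 2 < α) (hθ : 0 ≤ θ) (hs : 0 ≤ s) :
    ∫⁻ q : Plane, (1 - closestFactor α h θ s ‖q‖) =
      ENNReal.ofReal (Real.pi * (eta α θ 1 1 * s ^ 2 + h ^ 2 * (eta α θ 1 1 - 1))) := by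
  have hmeas : MeasurableSet {q : Plane | s ≤ ‖q‖} := measurableSet_le (by fun_prop) (by fun_prop)
  have hball : {q : Plane | s ≤ ‖q‖}ᶜ = Metric.ball 0 s := by
    ext q
    simp
  have hfar : ∫⁻ q in {q : Plane | s ≤ ‖q‖}, (1 - closestFactor α h θ s ‖q‖) =
      ENNReal.ofReal (Real.pi * (s ^ 2 + h ^ 2) * (eta α θ 1 1 - 1)) := by
    rw [setLIntegral_congr_fun (g := fun q : Plane => 1 - laplaceFactor α h θ s ‖q‖) hmeas
      fun q hq => by simp only [closestFactor, if_pos hq.out]]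
    rcases (by positivity : 0 ≤ s ^ 2 + h ^ 2).eq_or_lt with h0 | h0
    · -- At `s = h = 0` the pathloss to the serving station has the junk value `0`.
      have hα0 : α / 2 ≠ 0 := by linarith
      simp [laplaceFactor, div_eq_mul_inv _ (pathloss α h s), inv_pathloss, ← h0, hα0]
    · rw [lintegral_one_sub_laplaceFactor hα hθ hs h0, div_self h0.ne', Real.one_rpow, mul_one]
  have hnear : ∫⁻ q in Metric.ball (0 : Plane) s, (1 - closestFactor α h θ s ‖q‖) =
      ENNReal.ofReal (Real.pi * s ^ 2) := by
    rw [setLIntegral_congr_fun (g := fun _ => 1) measurableSet_ball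
      fun q hq => by simp [closestFactor, not_le.2 (mem_ball_zero_iff.1 hq)], setLIntegral_one,
      EuclideanSpace.volume_ball_fin_two, ← ENNReal.ofReal_pow hs,
      ← ENNReal.ofReal_mul (by positivity), mul_comm]
  have hη := one_le_eta hα hθ
  rw [← lintegral_add_compl _ hmeas, hball, hfar, hnear, ← ENNReal.ofReal_add]
  · congr 1
    ring
  · exact mul_nonneg (by positivity) (by linarith)
  · positivity

lemma lintegral_Ioi_zero_exp_neg_mul {c : ℝ} (hc : 0 < c) :
    ∫⁻ t in Ioi (0 : ℝ), ENNReal.ofReal (Real.exp (-c * t)) = ENNReal.ofReal (1 / c) := by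
  rw [← ofReal_integral_eq_lintegral_ofReal (integrableOn_exp_mul_Ioi (neg_lt_zero.2 hc) 0)
    (ae_of_all _ fun _ => (Real.exp_pos _).le), integral_exp_mul_Ioi (neg_lt_zero.2 hc), mul_zero,
    Real.exp_zero, neg_div_neg_eq]

lemma lintegral_exp_neg_mul_norm_sq {c : ℝ} (hc : 0 < c) :
    ∫⁻ q : Plane, ENNReal.ofReal (Real.exp (-c * ‖q‖ ^ 2)) = ENNReal.ofReal (Real.pi / c) := by
  have hint := lintegral_plane_norm_sq (f := fun t => ENNReal.ofReal (Real.exp (-c * t)))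
    (by fun_prop) le_rfl
  have huniv : {q : Plane | 0 ≤ ‖q‖} = univ := by simp
  rw [huniv, Measure.restrict_univ, zero_pow two_ne_zero, lintegral_Ioi_zero_exp_neg_mul hc,
    ← ENNReal.ofReal_mul Real.pi_pos.le, mul_one_div] at hint
  exact hint

lemma lintegral_Ioi_comp_div_sq (f : ℝ → ℝ≥0∞) {h : ℝ} (hh : 0 < h) :
    ∫⁻ r in Ioi h, ENNReal.ofReal (2 * r) * f ((r / h) ^ 2) =
      ENNReal.ofReal (h ^ 2) * ∫⁻ u in Ioi 1, f u := by
  have himg : (fun r : ℝ => (r / h) ^ 2) '' Ioi h = Ioi 1 := by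
    ext u
    constructor
    · rintro ⟨r, hr, rfl⟩
      exact one_lt_pow₀ ((one_lt_div hh).2 hr) two_ne_zero
    · intro hu
      refine ⟨h * √u, lt_mul_of_one_lt_right hh (Real.lt_sqrt_of_sq_lt (by simpa using hu)), ?_⟩
      simp only [mul_div_cancel_left₀ _ hh.ne', Real.sq_sqrt (zero_lt_one.trans hu).le]
  rw [← himg, lintegral_image_eq_lintegral_deriv_mul_of_monotoneOn measurableSet_Ioi
    (f' := fun r => 2 * r / h ^ 2)
    (fun r _ => by
      refine ((((hasDerivAt_id' r).div_const h).pow 2).congr_deriv ?_).hasDerivWithinAt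
      simp only [Nat.cast_ofNat, Nat.add_one_sub_one, pow_one]
      field_simp)
    (fun r hr r' _ hrr' => by
      have hr0 : 0 < r := hh.trans hr
      gcongr),
    ← lintegral_const_mul' _ _ ENNReal.ofReal_ne_top]
  refine lintegral_congr fun r => ?_
  rw [← mul_assoc, ← ENNReal.ofReal_mul (by positivity), mul_div_cancel₀ _ (by positivity)]

end

noncomputable section

variable {α h θ : ℝ} {lam : ℝ≥0}

lemma expNeg_lintegral_smul {E : Type*} [MeasurableSpace E] {ν : Measure E} {f : E → ℝ≥0∞} {v : ℝ}
    (hf : ∫⁻ q, f q ∂ν = ENNReal.ofReal v) (hv : 0 ≤ v) (c : ℝ≥0) :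
    expNeg (∫⁻ q, f q ∂(c • ν)) = ENNReal.ofReal (Real.exp (-(c * v))) := by
  rw [lintegral_smul_measure, hf, ENNReal.smul_def, smul_eq_mul, ← ENNReal.ofReal_coe_nnreal,
    ← ENNReal.ofReal_mul c.coe_nonneg, expNeg_ofReal (by positivity)]

lemma lintegral_expNeg_closestFactor (hlam : 0 < lam) (hα : 2 < α) (hθ : 0 ≤ θ) :
    ∫⁻ p : Plane, expNeg (∫⁻ q : Plane, (1 - closestFactor α h θ ‖p‖ ‖q‖) ∂(lam • volume))
        ∂(lam • volume) =
      ENNReal.ofReal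
        (1 / eta α θ 1 1 * Real.exp (-(Real.pi * lam * h ^ 2 * (eta α θ 1 1 - 1)))) := by
  have hη := one_le_eta hα hθ
  have : 0 ≤ eta α θ 1 1 - 1 := by linarith
  have : (0 : ℝ) < lam := hlam
  have hexp (p : Plane) :
      expNeg (∫⁻ q : Plane, (1 - closestFactor α h θ ‖p‖ ‖q‖) ∂(lam • volume)) =
        ENNReal.ofReal (Real.exp (-(Real.pi * lam * h ^ 2 * (eta α θ 1 1 - 1)))) *
          ENNReal.ofReal (Real.exp (-(Real.pi * lam * eta α θ 1 1) * ‖p‖ ^ 2)) := by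
    rw [expNeg_lintegral_smul (lintegral_one_sub_closestFactor hα hθ (norm_nonneg p))
      (by positivity), ← ENNReal.ofReal_mul (by positivity), ← Real.exp_add]
    ring_nf
  simp only [hexp]
  rw [lintegral_const_mul' _ _ ENNReal.ofReal_ne_top, lintegral_smul_measure,
    lintegral_exp_neg_mul_norm_sq (by positivity), ENNReal.smul_def, smul_eq_mul,
    ← ENNReal.ofReal_coe_nnreal, ← ENNReal.ofReal_mul (by positivity),
    ← ENNReal.ofReal_mul (by positivity)]
  congr 1
  field_simp

lemma measurable_eta_comp (hα : 2 < α) {f : ℝ → ℝ} (hf : Measurable f) (hf0 : ∀ t, 0 ≤ f t) :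
    Measurable fun t => eta α (f t) 1 1 := by
  simp only [eta_one_one_eq_one_add_integral hα (hf0 _)]
  exact ((stronglyMeasurable_integral_Ioi_div_add_rpow _).measurable.comp hf).const_add 1

lemma eta_mul_rpow {r : ℝ} (hr : 0 ≤ r) (hh : 0 < h) :
    eta α (θ * r ^ α) 1 h = eta α (θ * |(r / h) ^ 2| ^ (α / 2)) 1 1 := by
  rw [eta_one_eq_eta_one_one, abs_of_nonneg (by positivity), ← Real.rpow_natCast,
    ← Real.rpow_mul (by positivity), Real.div_rpow hr hh.le, mul_div_assoc]
  congr 3 <;> push_cast <;> ring_nf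

lemma integrableOn_Ioi_exp_eta_mul (hα : 2 < α) (hθ : 0 < θ) (hh : 0 < h) {c : ℝ} (hc : 0 < c) :
    IntegrableOn (fun r : ℝ => Real.exp (-(c * h ^ 2 * (eta α (θ * r ^ α) 1 h - 1))) * r)
      (Ioi h) := by
  set b := c * (θ / (1 + θ))
  have hb : 0 < b := by positivity
  refine ((integrable_mul_exp_neg_mul_sq hb).const_mul (Real.exp (b * h ^ 2))).integrableOn.mono'
    ?_ ?_
  · have hmeas : Measurable fun r : ℝ => eta α (θ * |(r / h) ^ 2| ^ (α / 2)) 1 1 :=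
      measurable_eta_comp hα (by fun_prop) fun r => by positivity
    refine (Measurable.aestronglyMeasurable (f := fun r : ℝ =>
      Real.exp (-(c * h ^ 2 * (eta α (θ * |(r / h) ^ 2| ^ (α / 2)) 1 1 - 1))) * r)
      (by fun_prop)).congr ?_
    filter_upwards [ae_restrict_mem measurableSet_Ioi] with r hr
    rw [eta_mul_rpow (hh.trans hr).le hh]
  · filter_upwards [ae_restrict_mem measurableSet_Ioi] with r hr
    have hr0 : 0 < r := hh.trans hr
    have hM : 1 ≤ (r / h) ^ 2 := one_le_pow₀ ((one_le_div hh).2 (mem_Ioi.1 hr).le)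
    have hη := mul_sub_one_le_eta_sub_one hα hθ.le hM
    rw [← abs_of_nonneg (sq_nonneg (r / h)), ← eta_mul_rpow hr0.le hh,
      abs_of_nonneg (by positivity)] at hη
    have hexp : b * r ^ 2 - b * h ^ 2 ≤ c * h ^ 2 * (eta α (θ * r ^ α) 1 h - 1) := by
      calc b * r ^ 2 - b * h ^ 2 = c * h ^ 2 * (θ / (1 + θ) * ((r / h) ^ 2 - 1)) := by
            simp only [b]
            field_simp
        _ ≤ _ := by gcongr
    rw [Real.norm_of_nonneg (by positivity), mul_comm r, ← mul_assoc, ← Real.exp_add]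
    gcongr
    linarith

lemma lintegral_Ioi_two_mul_exp_eta (hα : 2 < α) (hθ : 0 < θ) (hh : 0 < h) {c : ℝ} (hc : 0 < c) :
    ∫⁻ r in Ioi h, ENNReal.ofReal (2 * r) * ENNReal.ofReal
        (Real.exp (-(c * h ^ 2 * (eta α (θ * |(r / h) ^ 2| ^ (α / 2)) 1 1 - 1)))) =
      ENNReal.ofReal
        (2 * ∫ r in Ioi h, Real.exp (-(c * h ^ 2 * (eta α (θ * r ^ α) 1 h - 1))) * r) := by
  rw [ENNReal.ofReal_mul zero_le_two, ofReal_integral_eq_lintegral_ofReal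
    (integrableOn_Ioi_exp_eta_mul hα hθ hh hc), ← lintegral_const_mul' _ _ ENNReal.ofReal_ne_top]
  · refine setLIntegral_congr_fun measurableSet_Ioi fun r hr => ?_
    have hr0 : 0 < r := hh.trans hr
    simp only [eta_mul_rpow hr0.le hh]
    rw [← ENNReal.ofReal_mul (by positivity), ← ENNReal.ofReal_mul zero_le_two]
    ring_nf
  · filter_upwards [ae_restrict_mem measurableSet_Ioi] with r hr
    have hr0 : 0 < r := hh.trans hr
    simp only [Pi.zero_apply]
    positivity

lemma lintegral_expNeg_laplaceFactor (hα : 2 < α) (hθ : 0 < θ) (hh : 0 < h) (hlam : 0 < lam) :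
    ∫⁻ p : Plane, expNeg (∫⁻ q : Plane, (1 - laplaceFactor α h θ ‖p‖ ‖q‖) ∂(lam • volume))
        ∂(lam • volume) =
      ENNReal.ofReal (2 * Real.pi * lam * ∫ r in Ioi h,
        Real.exp (-(Real.pi * lam * h ^ 2 * (eta α (θ * r ^ α) 1 h - 1))) * r) := by
  have hlam' : (0 : ℝ) < lam := hlam
  -- The absolute value makes `f` measurable on all of `ℝ`; only `u ≥ 1` matters.
  set f : ℝ → ℝ≥0∞ := fun u => ENNReal.ofReal
    (Real.exp (-(Real.pi * lam * h ^ 2 * (eta α (θ * |u| ^ (α / 2)) 1 1 - 1)))) with hf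
  have hfm : Measurable f := by
    have : Measurable fun u : ℝ => eta α (θ * |u| ^ (α / 2)) 1 1 :=
      measurable_eta_comp hα (by fun_prop) fun u => by positivity
    fun_prop
  have huniv : {q : Plane | 0 ≤ ‖q‖} = univ := by simp
  have hexp (p : Plane) :
      expNeg (∫⁻ q : Plane, (1 - laplaceFactor α h θ ‖p‖ ‖q‖) ∂(lam • volume)) =
        f ((‖p‖ ^ 2 + h ^ 2) / (0 ^ 2 + h ^ 2)) := by
    have hlap := lintegral_one_sub_laplaceFactor (h := h) (s := ‖p‖) hα hθ.le le_rfl (by positivity)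
    rw [huniv, Measure.restrict_univ] at hlap
    have hη := one_le_eta (s := θ * ((‖p‖ ^ 2 + h ^ 2) / (0 ^ 2 + h ^ 2)) ^ (α / 2)) hα
      (by positivity)
    rw [expNeg_lintegral_smul hlap (mul_nonneg (by positivity) (by linarith)), hf]
    simp only [abs_of_nonneg (show 0 ≤ (‖p‖ ^ 2 + h ^ 2) / (0 ^ 2 + h ^ 2) by positivity)]
    ring_nf
  have hplane := lintegral_plane_norm_sq_add_div (h := h) hfm le_rfl (by positivity)
  rw [huniv, Measure.restrict_univ, zero_pow two_ne_zero, zero_add,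
    ENNReal.ofReal_mul Real.pi_pos.le, mul_assoc, ← lintegral_Ioi_comp_div_sq f hh] at hplane
  simp only [hexp]
  rw [lintegral_smul_measure, zero_pow two_ne_zero, zero_add, hplane,
    lintegral_Ioi_two_mul_exp_eta hα hθ hh (by positivity), ENNReal.smul_def, smul_eq_mul,
    ← ENNReal.ofReal_coe_nnreal, ← ENNReal.ofReal_mul Real.pi_pos.le,
    ← ENNReal.ofReal_mul hlam'.le]
  ring_nf

end

/-! ### Coverage -/

section

variable {Ω : Type*} {lam : ℝ≥0} {x : ℕ → Ω → Plane} {g : ℕ → Ω → ℝ} {α h θ : ℝ}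

lemma tprod_ne_closestFactor (i : ℕ) (ω : Ω) :
    ∏' j : {j // j ≠ i}, closestFactor α h θ ‖x i ω‖ ‖x j ω‖ =
      {ω | IsClosest x i ω}.indicator
        (fun ω => ∏' j : {j // j ≠ i}, laplaceFactor α h θ ‖x i ω‖ ‖x j ω‖) ω := by
  by_cases hi : IsClosest x i ω
  · rw [indicator_of_mem (by exact hi)]
    exact tprod_congr fun j => if_pos (hi j)
  · rw [indicator_of_notMem (by exact hi)]
    obtain ⟨j, hj⟩ := not_forall.1 hi
    have hji : j ≠ i := fun hji => hj (by rw [hji])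
    exact tprod_of_exists_eq_zero ⟨⟨j, hji⟩, if_neg hj⟩

lemma receivedPower_lt_of_one_lt_sir {i j : ℕ} {ω : Ω} (hij : i ≠ j)
    (hi : 1 < sir α h x g i ω) : receivedPower α h x g j ω < receivedPower α h x g i ω := by
  have hlt : interference α h x g i ω < receivedPower α h x g i ω := by
    by_contra! hle
    exact hi.not_ge (ENNReal.div_le_of_le_mul (by rwa [one_mul]))
  exact (ENNReal.le_tsum (f := fun k : {k : ℕ // k ≠ i} => receivedPower α h x g k ω)
    ⟨j, hij.symm⟩).trans_lt hlt

lemma eq_of_one_lt_sir {i j : ℕ} {ω : Ω} (hi : 1 < sir α h x g i ω) (hj : 1 < sir α h x g j ω) :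
    i = j := by
  by_contra hij
  exact lt_asymm (receivedPower_lt_of_one_lt_sir hij hi)
    (receivedPower_lt_of_one_lt_sir (Ne.symm hij) hj)

variable [MeasurableSpace Ω] {P : Measure Ω}

namespace IsHomogeneousPPP

lemma isPPP (hx : IsHomogeneousPPP P lam x) (hlam : 0 < lam) :
    IsPPP P (lam • volume) x := by
  have hfin {B : Set Plane} (hB : (lam • volume) B < ∞) : volume B < ∞ := by
    rw [Measure.smul_apply, ENNReal.smul_def, smul_eq_mul] at hB
    exact ENNReal.lt_top_of_mul_ne_top_right hB.ne (by exact_mod_cast hlam.ne')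
  refine ⟨hx.measurable_point, fun B hBm hB => ?_, fun n B hBm hB hdisj =>
    hx.count_indep n B hBm (fun j => hfin (hB j)) hdisj⟩
  have hlaw := hx.count_law B hBm (hfin hB)
  rw [Measure.smul_apply, ENNReal.smul_def, smul_eq_mul, ENNReal.toNNReal_mul,
    ENNReal.toNNReal_coe]
  exact hlaw

lemma lintegral_tsum_tprod_ne_norm (hx : IsHomogeneousPPP P lam x) (hlam : 0 < lam)
    {f : ℝ → ℝ → ℝ≥0∞} (hf : ∀ s, Measurable (f s)) (hf1 : ∀ s r, f s r ≤ 1)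
    (hanti : ∀ r, AntitoneOn (f · r) (Ici 0))
    (hcont : ∀ r s, ContinuousWithinAt (f · r) (Iic s) s) :
    ∫⁻ ω, ∑' i, ∏' j : {j // j ≠ i}, f ‖x i ω‖ ‖x j ω‖ ∂P =
      ∫⁻ p : Plane, expNeg (∫⁻ q : Plane, 1 - f ‖p‖ ‖q‖ ∂(lam • volume)) ∂(lam • volume) :=
  (hx.isPPP hlam).lintegral_tsum_tprod_ne (ρ := fun q => ‖q‖₊)
    (F := fun s q => f s ‖q‖) (by fun_prop) (fun s => (hf s).comp measurable_norm)
    (fun s q => hf1 s _) (fun q s s' hss' => hanti _ s.2 s'.2 hss')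
    (fun q s => (hcont _ _).comp NNReal.continuous_coe.continuousWithinAt fun t ht => ht)

lemma lintegral_tsum_tprod_ne_laplaceFactor (hx : IsHomogeneousPPP P lam x) (hlam : 0 < lam)
    (hα : 2 < α) (hθ : 0 < θ) (hh : 0 < h) :
    ∫⁻ ω, ∑' i, ∏' j : {j // j ≠ i}, laplaceFactor α h θ ‖x i ω‖ ‖x j ω‖ ∂P =
      ENNReal.ofReal (2 * Real.pi * lam * ∫ r in Ioi h,
        Real.exp (-(Real.pi * lam * h ^ 2 * (eta α (θ * r ^ α) 1 h - 1))) * r) := by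
  have hα0 : 0 ≤ α := by linarith
  rw [hx.lintegral_tsum_tprod_ne_norm hlam (f := laplaceFactor α h θ)
    (fun s => measurable_laplaceFactor measurable_const measurable_id)
    (fun s r => laplaceFactor_le_one hθ.le)
    (fun r s hs s' _ hss' => laplaceFactor_anti hα0 hθ.le hs hss')
    (fun r s => (continuous_laplaceFactor hα0 hθ.le).continuousWithinAt)]
  exact lintegral_expNeg_laplaceFactor hα hθ hh hlam

lemma lintegral_tsum_indicator_isClosest_laplaceFactor (hx : IsHomogeneousPPP P lam x)
    (hlam : 0 < lam) (hα : 2 < α) (hθ : 0 ≤ θ) :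
    ∫⁻ ω, ∑' i, {ω | IsClosest x i ω}.indicator
        (fun ω => ∏' j : {j // j ≠ i}, laplaceFactor α h θ ‖x i ω‖ ‖x j ω‖) ω ∂P =
      ENNReal.ofReal
        (1 / eta α θ 1 1 * Real.exp (-(Real.pi * lam * h ^ 2 * (eta α θ 1 1 - 1)))) := by
  have hα0 : 0 ≤ α := by linarith
  simp only [← tprod_ne_closestFactor]
  rw [hx.lintegral_tsum_tprod_ne_norm hlam (f := closestFactor α h θ)
    (fun s => measurable_closestFactor)
    (fun s r => closestFactor_le_one hθ)
    (fun r s hs s' _ hss' => closestFactor_anti hα0 hθ hs hss')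
    (fun r s => continuousWithinAt_closestFactor hα0 hθ)]
  exact lintegral_expNeg_closestFactor hlam hα hθ

lemma measurableSet_isClosest (hx : IsHomogeneousPPP P lam x) (i : ℕ) :
    MeasurableSet {ω | IsClosest x i ω} := by
  simp only [IsClosest, ofPred_forall]
  exact .iInter fun j => measurableSet_le (hx.measurable_point i).norm (hx.measurable_point j).norm

lemma ae_forall_ne_zero (hx : IsHomogeneousPPP P lam x) (hlam : 0 < lam) :
    ∀ᵐ ω ∂P, ∀ i, x i ω ≠ 0 := by
  have hcount := (hx.isPPP hlam).lintegral_tsum_indicator (measurableSet_singleton 0)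
    (by simp)
  have hmeas : ∀ i, Measurable fun ω => ({0} : Set Plane).indicator (1 : Plane → ℝ≥0∞) (x i ω) :=
    fun i => (measurable_one.indicator (measurableSet_singleton 0)).comp (hx.measurable_point i)
  rw [Measure.smul_apply, measure_singleton, smul_zero,
    lintegral_eq_zero_iff (.tsum hmeas)] at hcount
  filter_upwards [hcount] with ω hω i hi
  have h0 := ENNReal.tsum_eq_zero.1 hω i
  simp [hi] at h0

lemma ae_exists_isClosest (hx : IsHomogeneousPPP P lam x) (hlam : 0 < lam) :
    ∀ᵐ ω ∂P, ∃ i, IsClosest x i ω := by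
  have hfin : ∀ᵐ ω ∂P, ∀ M : ℕ, {i | x i ω ∈ Metric.closedBall 0 M}.Finite :=
    ae_all_iff.2 fun M => (hx.isPPP hlam).ae_finite measurableSet_closedBall
      (isCompact_closedBall 0 (M : ℝ)).measure_lt_top
  filter_upwards [hfin] with ω hω
  simp only [mem_closedBall_zero_iff] at hω
  obtain ⟨M, hM⟩ := exists_nat_ge ‖x 0 ω‖
  obtain ⟨i, hi, hmin⟩ := exists_min_image _ (fun i => ‖x i ω‖) (hω M) ⟨0, hM⟩
  refine ⟨i, fun j => ?_⟩
  rcases le_total ‖x j ω‖ M with hj | hj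
  exacts [hmin j hj, hi.out.trans hj]

lemma lintegral_tsum_indicator_isClosest (hx : IsHomogeneousPPP P lam x) (hlam : 0 < lam) :
    ∫⁻ ω, ∑' i, {ω | IsClosest x i ω}.indicator 1 ω ∂P = 1 := by
  -- For `θ = 0` all factors are `1`, whatever the pathloss exponent `α > 2`.
  have hone : ∀ s r, laplaceFactor 3 0 0 s r = 1 := by simp [laplaceFactor]
  have heta : eta 3 0 1 1 = 1 := eta_zero (by norm_num)
  simpa [hone, heta, Pi.one_def] using
    hx.lintegral_tsum_indicator_isClosest_laplaceFactor (h := 0) hlam (α := 3) (by norm_num) le_rfl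

lemma ae_isClosest_unique (hx : IsHomogeneousPPP P lam x) (hlam : 0 < lam) :
    ∀ᵐ ω ∂P, ∀ i j, IsClosest x i ω → IsClosest x j ω → i = j := by
  have := (hx.isPPP hlam).isProbabilityMeasure
  let N (ω : Ω) : ℝ≥0∞ := ∑' i, {ω | IsClosest x i ω}.indicator 1 ω
  have hle : (fun _ => 1) ≤ᵐ[P] N := by
    filter_upwards [hx.ae_exists_isClosest hlam] with ω ⟨i, hi⟩
    refine le_trans ?_ (ENNReal.le_tsum i)
    rw [indicator_of_mem (by exact hi), Pi.one_apply]
  have hN : ∫⁻ ω, N ω ∂P ≤ ∫⁻ _, 1 ∂P := by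
    simpa using (hx.lintegral_tsum_indicator_isClosest hlam).le
  have heq := ae_eq_of_ae_le_of_lintegral_le hle (by simp) (Measurable.aemeasurable (.tsum fun i =>
    measurable_one.indicator (hx.measurableSet_isClosest i))) hN
  filter_upwards [heq] with ω hω i j hi hj
  by_contra hij
  have h2 := ENNReal.sum_le_tsum (f := fun i => {ω | IsClosest x i ω}.indicator (1 : Ω → ℝ≥0∞) ω)
    {i, j}
  rw [Finset.sum_pair hij, indicator_of_mem (by exact hi), indicator_of_mem (by exact hj)] at h2
  exact absurd (h2.trans hω.ge) (by norm_num [one_add_one_eq_two])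

end IsHomogeneousPPP

namespace IsRayleighMarkedPPP

lemma measurable_receivedPower (hxg : IsRayleighMarkedPPP P lam x g) (i : ℕ) :
    Measurable (receivedPower α h x g i) := by
  have hgi := hxg.measurable_gain i
  have hxi := (hxg.ppp.measurable_point i).norm
  unfold receivedPower pathloss
  fun_prop

lemma measurable_sir (hxg : IsRayleighMarkedPPP P lam x g) (i : ℕ) :
    Measurable (sir α h x g i) :=
  (hxg.measurable_receivedPower i).div (.tsum fun j => hxg.measurable_receivedPower j)

lemma measurableSet_lt_sir (hxg : IsRayleighMarkedPPP P lam x g) (i : ℕ) :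
    MeasurableSet {ω | ENNReal.ofReal θ < sir α h x g i ω} :=
  measurableSet_lt measurable_const (hxg.measurable_sir i)

lemma measurable_tprod_ne_laplaceFactor (hxg : IsRayleighMarkedPPP P lam x g) (i : ℕ) :
    Measurable fun ω => ∏' j : {j // j ≠ i}, laplaceFactor α h θ ‖x i ω‖ ‖x j ω‖ :=
  .tprod fun j => measurable_laplaceFactor (hxg.ppp.measurable_point i).norm
    (hxg.ppp.measurable_point j).norm

theorem coverageStrongest_eq (hxg : IsRayleighMarkedPPP P lam x g) (hθ : 1 ≤ θ) :
    coverageStrongest P α h x g θ = (meanCoveringStations P α h x g θ).toReal := by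
  have hsub : ∀ ω, {i | ENNReal.ofReal θ < sir α h x g i ω}.Subsingleton := fun ω i hi j hj =>
    eq_of_one_lt_sir ((ENNReal.one_le_ofReal.2 hθ).trans_lt hi)
      ((ENNReal.one_le_ofReal.2 hθ).trans_lt hj)
  have hset : {ω | ∃ i, IsStrongest α h x g i ω ∧ ENNReal.ofReal θ < sir α h x g i ω} =
      {ω | ∃ i, ENNReal.ofReal θ < sir α h x g i ω} := by
    ext ω
    refine ⟨fun ⟨i, hi⟩ => ⟨i, hi.2⟩, fun ⟨i, hi⟩ => ⟨i, fun j => ?_, hi⟩⟩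
    by_contra! hlt
    rw [hsub ω hi (hi.trans hlt)] at hlt
    exact lt_irrefl _ hlt
  have hm : MeasurableSet {ω | ∃ i, ENNReal.ofReal θ < sir α h x g i ω} := by
    rw [ofPred_exists]
    exact .iUnion hxg.measurableSet_lt_sir
  rw [coverageStrongest, hset, measureReal_def, ← lintegral_indicator_one hm, meanCoveringStations]
  congr 1
  refine lintegral_congr fun ω => ?_
  by_cases hω : ∃ i, ENNReal.ofReal θ < sir α h x g i ω
  · obtain ⟨i, hi⟩ := hω
    rw [indicator_of_mem (by exact ⟨i, hi⟩), (hsub ω).eq_singleton_of_mem hi, encard_singleton]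
    simp
  · rw [indicator_of_notMem (by exact hω)]
    push Not at hω
    simp [not_lt.2 (hω _)]

lemma measure_lt_sir_of_fixed_points (hxg : IsRayleighMarkedPPP P lam x g) (hθ : 0 < θ)
    {p : ℕ → Plane} (hp : ∀ j, 0 < ‖p j‖ ^ 2 + h ^ 2) (i : ℕ) :
    P {ω | ENNReal.ofReal θ < sir α h (fun j _ => p j) g i ω} =
      ∏' j : {j // j ≠ i}, laplaceFactor α h θ ‖p i‖ ‖p j‖ := by
  have hℓ : ∀ j, 0 < pathloss α h ‖p j‖ := fun j => pathloss_pos (hp j)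
  refine Eq.trans (congrArg P ?_) (measure_tsum_ne_lt_eq_tprod_ne hxg.measurable_gain hxg.gain_law
    hxg.gain_indep (c := fun j => θ * pathloss α h ‖p j‖ / pathloss α h ‖p i‖)
    (fun j => div_nonneg (mul_nonneg hθ.le (hℓ j).le) (hℓ i).le) i)
  ext ω
  exact ofReal_lt_div_tsum_ne_iff (a := fun j => g j ω) (ℓ := fun j => pathloss α h ‖p j‖) (hℓ i) hθ

lemma measure_inter_lt_sir (hxg : IsRayleighMarkedPPP P lam x g) (hθ : 0 < θ)
    (hpos : ∀ᵐ ω ∂P, ∀ i, 0 < ‖x i ω‖ ^ 2 + h ^ 2) {A : Set (ℕ → Plane)} (hA : MeasurableSet A)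
    (i : ℕ) :
    P {ω | (fun j => x j ω) ∈ A ∧ ENNReal.ofReal θ < sir α h x g i ω} =
      ∫⁻ ω, {ω | (fun j => x j ω) ∈ A}.indicator
        (fun ω => ∏' j : {j // j ≠ i}, laplaceFactor α h θ ‖x i ω‖ ‖x j ω‖) ω ∂P := by
  have hxm : Measurable fun ω j => x j ω := measurable_pi_lambda _ hxg.ppp.measurable_point
  have hgm : Measurable fun ω j => g j ω := measurable_pi_lambda _ hxg.measurable_gain
  have := hxg.gain_indep.isProbabilityMeasure
  let S (q : (ℕ → Plane) × (ℕ → ℝ)) : ℝ≥0∞ :=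
    sir α h (fun j (q : (ℕ → Plane) × (ℕ → ℝ)) => q.1 j) (fun j q => q.2 j) i q
  have hS : Measurable S := by
    have hrp : ∀ j, Measurable fun q : (ℕ → Plane) × (ℕ → ℝ) =>
        ENNReal.ofReal (q.2 j * pathloss α h ‖q.1 j‖) := fun j => by
      unfold pathloss
      fun_prop
    exact (hrp i).div (.tsum fun j => hrp j)
  have hH : MeasurableSet {q | q.1 ∈ A ∧ ENNReal.ofReal θ < S q} :=
    (measurable_fst hA).inter (measurableSet_lt measurable_const hS)
  have hprod :=
    (indepFun_iff_map_prod_eq_prod_map_map hxm.aemeasurable hgm.aemeasurable).1 hxg.indep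
  change P ((fun ω => (fun j => x j ω, fun j => g j ω)) ⁻¹' {q | q.1 ∈ A ∧ ENNReal.ofReal θ < S q})
    = _
  rw [← Measure.map_apply (hxm.prodMk hgm) hH, hprod, Measure.prod_apply hH,
    lintegral_map (measurable_measure_prodMk_left hH) hxm]
  refine lintegral_congr_ae (hpos.mono fun ω hω => ?_)
  dsimp only
  rw [Measure.map_apply hgm (measurable_prodMk_left hH)]
  by_cases hωA : (fun j => x j ω) ∈ A
  · rw [indicator_of_mem (by exact hωA), ← hxg.measure_lt_sir_of_fixed_points hθ hω i]
    congr 1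
    ext ω'
    simp only [preimage_ofPred_eq, mem_ofPred_eq, hωA, true_and]
    rfl
  · rw [indicator_of_notMem (by exact hωA)]
    simp [hωA]

theorem coverageClosest_eq (hxg : IsRayleighMarkedPPP P lam x g) (hlam : 0 < lam) (hα : 2 < α)
    (hθ : 0 < θ) (h : ℝ) :
    coverageClosest P α h x g θ =
      1 / eta α θ 1 1 * Real.exp (-(Real.pi * lam * h ^ 2 * (eta α θ 1 1 - 1))) := by
  have hpos : ∀ᵐ ω ∂P, ∀ i, 0 < ‖x i ω‖ ^ 2 + h ^ 2 := by
    filter_upwards [hxg.ppp.ae_forall_ne_zero hlam] with ω hω i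
    have := norm_pos_iff.2 (hω i)
    positivity
  have hA : ∀ i, MeasurableSet {p : ℕ → Plane | ∀ j, ‖p i‖ ≤ ‖p j‖} := fun i => by
    simp only [ofPred_forall]
    exact .iInter fun j =>
      measurableSet_le (measurable_pi_apply i).norm (measurable_pi_apply j).norm
  have hcover : ∀ i, P {ω | IsClosest x i ω ∧ ENNReal.ofReal θ < sir α h x g i ω} =
      ∫⁻ ω, {ω | IsClosest x i ω}.indicator
        (fun ω => ∏' j : {j // j ≠ i}, laplaceFactor α h θ ‖x i ω‖ ‖x j ω‖) ω ∂P := fun i =>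
    hxg.measure_inter_lt_sir hθ hpos (hA i) i
  have hdisj : Pairwise (Function.onFun (AEDisjoint P) fun i =>
      {ω | IsClosest x i ω ∧ ENNReal.ofReal θ < sir α h x g i ω}) := fun i j hij => by
    refine measure_mono_null ?_ (hxg.ppp.ae_isClosest_unique hlam)
    exact fun ω ⟨hi, hj⟩ hu => hij (hu i j hi.1 hj.1)
  have hη := one_le_eta hα hθ.le
  rw [coverageClosest, ofPred_exists, measureReal_def, measure_iUnion₀ hdisj fun i =>
      ((hxg.ppp.measurableSet_isClosest i).inter (hxg.measurableSet_lt_sir i)).nullMeasurableSet,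
    tsum_congr hcover,
    ← lintegral_tsum fun i => ((hxg.measurable_tprod_ne_laplaceFactor i).indicator
      (hxg.ppp.measurableSet_isClosest i)).aemeasurable,
    hxg.ppp.lintegral_tsum_indicator_isClosest_laplaceFactor hlam hα hθ.le,
    ENNReal.toReal_ofReal (by positivity)]

theorem meanCoveringStations_eq (hxg : IsRayleighMarkedPPP P lam x g) (hlam : 0 < lam)
    (hα : 2 < α) (hθ : 0 < θ) (hh : 0 < h) :
    meanCoveringStations P α h x g θ =
      ENNReal.ofReal (2 * Real.pi * lam * ∫ r in Ioi h,
        Real.exp (-(Real.pi * lam * h ^ 2 * (eta α (θ * r ^ α) 1 h - 1))) * r) := by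
  have hcover : ∀ i, P {ω | ENNReal.ofReal θ < sir α h x g i ω} =
      ∫⁻ ω, ∏' j : {j // j ≠ i}, laplaceFactor α h θ ‖x i ω‖ ‖x j ω‖ ∂P := fun i => by
    simpa using hxg.measure_inter_lt_sir (α := α) (h := h) hθ (.of_forall fun ω i => by positivity)
      MeasurableSet.univ i
  calc meanCoveringStations P α h x g θ
    _ = ∫⁻ ω, ∑' i, {ω | ENNReal.ofReal θ < sir α h x g i ω}.indicator 1 ω ∂P :=
      lintegral_congr fun ω => by
        rw [← ENNReal.tsum_set_one, tsum_subtype _ fun _ => 1]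
        rfl
    _ = ∑' i, P {ω | ENNReal.ofReal θ < sir α h x g i ω} := by
      rw [lintegral_tsum fun i =>
        (measurable_one.indicator (hxg.measurableSet_lt_sir i)).aemeasurable]
      exact tsum_congr fun i => lintegral_indicator_one (hxg.measurableSet_lt_sir i)
    _ = ∫⁻ ω, ∑' i, ∏' j : {j // j ≠ i}, laplaceFactor α h θ ‖x i ω‖ ‖x j ω‖ ∂P := by
      rw [tsum_congr hcover, lintegral_tsum fun i =>
        (hxg.measurable_tprod_ne_laplaceFactor i).aemeasurable]
    _ = _ := hxg.ppp.lintegral_tsum_tprod_ne_laplaceFactor hlam hα hθ hh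

end IsRayleighMarkedPPP

end

end

theorem mainTheorem4 {Ω : Type*} [MeasurableSpace Ω] (P : Measure Ω) [IsProbabilityMeasure P]
    (lam : ℝ≥0) (hlam : 0 < lam) (α : ℝ) (hα : 2 < α) (θ : ℝ) (hθ : 0 < θ)
    (x : ℕ → Ω → Plane) (g : ℕ → Ω → ℝ) (hxg : IsRayleighMarkedPPP P lam x g) :
    (∀ h : ℝ, 0 ≤ h →
      coverageClosest P α h x g θ =
        1 / eta α θ 1 1 * Real.exp (-(Real.pi * lam * h ^ 2 * (eta α θ 1 1 - 1)))) ∧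
    (∀ h : ℝ, 0 < h →
      IntegrableOn
        (fun r : ℝ => Real.exp (-(Real.pi * lam * h ^ 2 * (eta α (θ * r ^ α) 1 h - 1))) * r)
        (Set.Ioi h) ∧
      meanCoveringStations P α h x g θ =
        ENNReal.ofReal (2 * Real.pi * lam * ∫ r in Set.Ioi h,
          Real.exp (-(Real.pi * lam * h ^ 2 * (eta α (θ * r ^ α) 1 h - 1))) * r) ∧
      (1 ≤ θ →
        coverageStrongest P α h x g θ =
          2 * Real.pi * lam * ∫ r in Set.Ioi h,
            Real.exp (-(Real.pi * lam * h ^ 2 * (eta α (θ * r ^ α) 1 h - 1))) * r)) := by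
  refine ⟨fun h _ => hxg.coverageClosest_eq hlam hα hθ h, fun h hh => ?_⟩
  have hmean := hxg.meanCoveringStations_eq hlam hα hθ hh
  have hlam' : 0 < Real.pi * lam := mul_pos Real.pi_pos (by exact_mod_cast hlam)
  refine ⟨integrableOn_Ioi_exp_eta_mul hα hθ hh hlam', hmean, fun hθ1 => ?_⟩
  have hnonneg : 0 ≤ ∫ r in Set.Ioi h,
      Real.exp (-(Real.pi * lam * h ^ 2 * (eta α (θ * r ^ α) 1 h - 1))) * r :=
    setIntegral_nonneg measurableSet_Ioi fun r hr =>
      mul_nonneg (Real.exp_nonneg _) (hh.trans hr).le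
  rw [hxg.coverageStrongest_eq hθ1, hmean, ENNReal.toReal_ofReal]
  positivity
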